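/- Theorem. Let $(X,\mu)$ be a standard probability space and let $\mathbb R\curvearrowright X$, $(x,t)\mapsto x+t$, be a free Borel measure-preserving flow (free: $x+t=x$ implies $t=0$). For $y$ in the orbit $x+\mathbb R$ let $\rho(x,y)$ be the unique real with $x+\rho(x,y)=y$, and let $\lambda_x$ be the push-forward of Lebesgue measure $\lambda$ to this orbit, $\lambda_x(A)=\lambda(\{t\in\mathbb R: x+t\in A\})$. The full group $[\mathbb R\curvearrowright X]$ consists of all measure-preserving automorphisms $T$ of $(X,\mu)$ such that $Tx\in x+\mathbb R$ for all $x\in X$; the cocycle of such a $T$ is $\rho_T(x)=\rho(x,Tx)$. Then there exists $S\in[\mathbb R\curvearrowright X]$ such that: 1. the cocycle of $S$ is bounded by $4$: $|\rho_S(x)|\le 4$ for all $x\in X$; 2. $S$ acts ergodically on every orbit of the flow: for every $x\in X$, $S$ preserves $\lambda_x$, and every $S$-invariant Borel set is either $\lambda_x$-null or $\lambda_x$-conull; 3. the signs in $\{\rho_{S^k}(x):k\in\mathbb N\}$ keep alternating indefinitely for almost all $x$: for $\mu$-almost every $x\in X$ there are infinitely many $k\in\mathbb N$ with $\rho_{S^k}(x)>0$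 and infinitely many $k\in\mathbb N$ with $\rho_{S^k}(x)<0$. -/

import Mathlib

open MeasureTheory Filter

/-- A flow (action of `ℝ`) is free if no nonzero real fixes a point. -/
def IsFreeFlow (X : Type*) [AddAction ℝ X] : Prop :=
  ∀ (x : X) (t : ℝ), t +ᵥ x = x → t = 0

/-- The full group of a measure-preserving flow: the measure-preserving (Borel) automorphisms `T`
of `(X, μ)` such that `T x` lies in the orbit of `x` for all `x`. -/
def fullGroup {X : Type*} [MeasurableSpace X] [AddAction ℝ X] (μ : Measure X) : Subgroup (Equiv.Perm X) where
  carrier := {T | MeasurePreserving T μ μ ∧ MeasurePreserving T.symm μ μ ∧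
    ∀ x, T x ∈ AddAction.orbit ℝ x}
  mul_mem' := by
    rintro S T ⟨hS, hS', hS''⟩ ⟨hT, hT', hT''⟩
    refine ⟨hS.comp hT, hT'.comp hS', fun x => ?_⟩
    have h := hS'' (T x)
    rwa [AddAction.orbit_eq_iff.2 (hT'' x)] at h
  one_mem' := ⟨MeasurePreserving.id μ, MeasurePreserving.id μ, fun x => AddAction.mem_orbit_self x⟩
  inv_mem' := by
    rintro T ⟨hT, hT', hT''⟩
    refine ⟨hT', hT, fun x => ?_⟩
    have h := hT'' (T.symm x)
    rw [Equiv.apply_symm_apply] at h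
    exact (AddAction.mem_orbit_symm).1 h

open Classical in
/-- The cocycle `ρ(x, y)` of a free flow: the unique real `t` with `x + t = y`, for `x` and `y` in
the same orbit (and the value `0` if they are not in the same orbit). -/
noncomputable def orbitCocycle {X : Type*} [AddAction ℝ X] (x y : X) : ℝ :=
  if h : ∃ t : ℝ, t +ᵥ x = y then h.choose else 0

theorem orbitCocycle_vadd_self {X : Type*} [AddAction ℝ X] {x y : X}
    (h : y ∈ AddAction.orbit ℝ x) : orbitCocycle x y +ᵥ x = y := by
  have h' : ∃ t : ℝ, t +ᵥ x = y := h
  rw [orbitCocycle, dif_pos h']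
  exact h'.choose_spec

theorem orbitCocycle_eq {X : Type*} [AddAction ℝ X] (hfree : IsFreeFlow X) (x : X) (t : ℝ) :
    orbitCocycle x (t +ᵥ x) = t := by
  have h := orbitCocycle_vadd_self (AddAction.mem_orbit x t)
  have h2 : (-t + orbitCocycle x (t +ᵥ x)) +ᵥ x = x := by
    rw [add_vadd, h, neg_vadd_vadd]
  have := hfree x _ h2
  linarith

/-- The cocycle map `ρ_T(x) = ρ(x, T x)` of an element `T` of the full group. -/
noncomputable def cocycleMap {X : Type*} [AddAction ℝ X] (T : Equiv.Perm X) (x : X) : ℝ :=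
  orbitCocycle x (T x)

/-- The measure `λ_x` on the orbit of `x`: the image of Lebesgue measure under `t ↦ x + t`, i.e.
`λ_x(A) = λ({t | x + t ∈ A})`. It is carried by the orbit of `x`. -/
noncomputable def orbitMeasure {X : Type*} [MeasurableSpace X] [AddAction ℝ X] (x : X) : Measure X :=
  Measure.map (fun t : ℝ => t +ᵥ x) volume

/-- `T` acts ergodically on the orbit of `x`: as a transformation of the orbit with its measure
`λ_x`, it preserves the measure and every invariant set is null or conull. -/
def ErgodicOnOrbit {X : Type*} [MeasurableSpace X] [AddAction ℝ X]
    (T : Equiv.Perm X) (x : X) : Prop :=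
  Ergodic T (orbitMeasure x)

open scoped Topology symmDiff

/-! Each orbit, identified with the line, is cut into cells whose lengths lie between `u` and `2 *
u`, where `u ≤ 1` is constant on the orbit. A cell is a tower with one full floor of length `u` and
at most one more, possibly partial. The map `S` climbs by `u` while this stays in the cell.
Otherwise it jumps to the bottom of the next or the previous cell, rotating the bottom, read as a
circle, by an angle `α`. The map induced on the bottoms is the skew product `(y, n) ↦ (y + α, n ±
1)` on circle × ℤ, so `S` is ergodic on the line once the skew product is (`IsTowerMap.ergodic`).
Jumps have length at most `4 * u`.

The sign is `1` on one half of the circle and `-1` on the other. The Liouville number `α` is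
extremely close to fractions `p / q` with `q` odd. For such `q` the sum of `q` consecutive signs is
exactly `1` on a quarter of the circle, whereas rotation by `q * α` is nearly the identity. Hence
consecutive slices of an invariant set agree almost everywhere, and the common slice is invariant
under an irrational rotation (`rotation_extension_ergodic`).

The cells are chosen in a Borel way on all orbits at once (`exists_isCrossSection`). Freeness makes
some local density function nonconstant on each orbit; its upcrossings form a separated Borel set,
whose gaps are then filled at scale `u`.

Since Lebesgue measure has no atoms, an ergodic bijection of the line is conservative, so almost
every point visits every unit interval infinitely often, on its left and on its right
(`Ergodic.ae_frequently_lt_and_gt`). Fubini carries statements on orbits over to `μ`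
(`measurePreserving_of_orbits`, `measure_eq_zero_of_orbitTrace`). -/

/-! ### An ergodic integer extension of an irrational rotation -/

/-- The angle of the rotation underlying the construction. -/
noncomputable def rotationAngle : ℝ := liouvilleNumber 3

/-- The step function `±1` on the two halves of the circle `ℝ / ℤ`, as a function on `ℝ`. -/
noncomputable def rotationStep (t : ℝ) : ℤ := if Int.fract t < 1 / 2 then 1 else -1

/-- Over the denominator `3 ^ k!` the last term contributes `1` to the numerator and the earlier
ones a multiple of `3`. This needs `k! > (k - 1)!`, hence `2 ≤ k`. -/
theorem exists_coprime_liouvilleNumber_three (k : ℕ) (hk : 2 ≤ k) :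
    ∃ p : ℕ, p % 3 = 1 ∧
      LiouvilleNumber.partialSum 3 k = p / (3 : ℝ) ^ k.factorial := by
  obtain ⟨k, rfl⟩ := Nat.exists_eq_add_of_le' hk
  obtain ⟨p, hp⟩ := LiouvilleNumber.partialSum_eq_rat (m := 3) (by norm_num) (k + 1)
  have hfac : (k + 1 + 1).factorial = (k + 1).factorial + ((k + 1) * (k + 1).factorial) := by
    rw [Nat.factorial_succ]; ring
  refine ⟨p * 3 ^ ((k + 1) * (k + 1).factorial) + 1, ?_, ?_⟩
  · have : 3 ∣ 3 ^ ((k + 1) * (k + 1).factorial) := dvd_pow_self 3 (by positivity)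
    obtain ⟨c, hc⟩ := this
    rw [hc]
    have : p * (3 * c) + 1 = 3 * (p * c) + 1 := by ring
    omega
  · push_cast at hp
    rw [show k + 2 = k + 1 + 1 from rfl, LiouvilleNumber.partialSum_succ, hp, hfac, pow_add]
    push_cast
    field_simp

/-- With `q = 3 ^ k!`, the drift away from the rational rotation during `q` steps is at most `q *
ε`, and the third inequality says that this is a small part of the mesh `1 / q`. -/
theorem exists_rotationAngle_eq (k : ℕ) (hk : 3 ≤ k) :
    ∃ (p : ℕ) (ε : ℝ), Nat.Coprime p (3 ^ k.factorial) ∧ 0 ≤ ε ∧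
      (3 : ℝ) ^ k.factorial * ((3 : ℝ) ^ k.factorial * ε) ≤ 1 / (3 : ℝ) ^ k.factorial ∧
      rotationAngle = p / (3 : ℝ) ^ k.factorial + ε := by
  obtain ⟨p, hp3, hp⟩ := exists_coprime_liouvilleNumber_three k (by omega)
  refine ⟨p, LiouvilleNumber.remainder 3 k, ?_, ?_, ?_, ?_⟩
  · apply Nat.Coprime.pow_right
    rw [Nat.coprime_comm, Nat.Prime.coprime_iff_not_dvd Nat.prime_three]
    omega
  · exact (LiouvilleNumber.remainder_pos (by norm_num) k).le
  · have h := (LiouvilleNumber.remainder_lt k (m := 3) (by norm_num)).le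
    set q : ℝ := (3 : ℝ) ^ k.factorial with hq
    have hq1 : 1 ≤ q := one_le_pow₀ (by norm_num)
    have h3 : LiouvilleNumber.remainder 3 k ≤ 1 / q ^ 3 :=
      h.trans (one_div_le_one_div_of_le (by positivity) (pow_le_pow_right₀ hq1 hk))
    calc q * (q * LiouvilleNumber.remainder 3 k) ≤ q * (q * (1 / q ^ 3)) := by gcongr
      _ = 1 / q := by field_simp
  · rw [rotationAngle, ← LiouvilleNumber.partialSum_add_remainder (by norm_num) k, hp]

theorem irrational_rotationAngle : Irrational rotationAngle := by
  have := liouville_liouvilleNumber (m := 3) (by norm_num)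
  exact_mod_cast this.irrational

theorem sum_range_zmod_affine {M : Type*} [AddCommMonoid M] {q : ℕ} [NeZero q] (a : (ZMod q)ˣ)
    (b : ZMod q) (g : ZMod q → M) :
    ∑ j ∈ Finset.range q, g (b + j * a) = ∑ z, g z := by
  refine Finset.sum_nbij (fun j : ℕ => b + j * a) (fun _ _ => Finset.mem_univ _) ?_ ?_
    fun _ _ => rfl
  · intro i hi j hj hij
    have h : (i : ZMod q) = j := by simpa using hij
    rw [ZMod.natCast_eq_natCast_iff'] at h
    rwa [Nat.mod_eq_of_lt (by simpa using hi), Nat.mod_eq_of_lt (by simpa using hj)] at h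
  · intro z _
    refine ⟨((z - b) * ((a⁻¹ : (ZMod q)ˣ) : ZMod q)).val, ?_, ?_⟩
    · simpa using ZMod.val_lt _
    · simp [mul_assoc]

/-- For odd `q` the jump at `1 / 2` is the midpoint of a mesh interval, so the sign depends only on
the interval as long as the point stays in its left half. -/
theorem rotationStep_div {q m : ℕ} (hq : q = 2 * m + 1) (i : ℤ) {r : ℝ} (h0 : 0 ≤ r)
    (h1 : r < 1 / 2) :
    rotationStep ((i + r) / q) = if (i : ZMod q).val ≤ m then 1 else -1 := by
  have hq0 : (0 : ℝ) < q := by rw [hq]; positivity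
  have : NeZero q := ⟨by omega⟩
  set v := (i : ZMod q).val with hv
  have hvi : (v : ℤ) = i % q := ZMod.val_intCast i
  have hvq : v < q := ZMod.val_lt _
  have hvr : (v : ℝ) + 1 ≤ q := by exact_mod_cast hvq
  have hqr : (q : ℝ) = 2 * m + 1 := by exact_mod_cast hq
  have hfr : Int.fract (((i : ℝ) + r) / q) = (v + r) / q := by
    rw [Int.fract_eq_iff]
    refine ⟨by positivity, by rw [div_lt_one hq0]; linarith, i / q, ?_⟩
    have : (i : ℝ) = q * (i / q : ℤ) + v := by
      have := Int.mul_ediv_add_emod i q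
      rw [← hvi] at this
      exact_mod_cast this.symm
    rw [this]
    field_simp
    ring
  rw [rotationStep, hfr]
  congr 1
  rw [div_lt_iff₀ hq0, eq_iff_iff]
  constructor
  · intro h
    by_contra! hlt
    have : (m : ℝ) + 1 ≤ v := by exact_mod_cast hlt
    linarith
  · intro h
    have : (v : ℝ) ≤ m := by exact_mod_cast h
    linarith

theorem sum_zmod_half (m : ℕ) :
    ∑ z : ZMod (2 * m + 1), (if z.val ≤ m then (1 : ℤ) else -1) = 1 := by
  rw [← sum_range_zmod_affine 1 0]
  have h : ∀ j ∈ Finset.range (2 * m + 1),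
      (if ((0 : ZMod (2 * m + 1)) + j * ((1 : (ZMod (2 * m + 1))ˣ) : ZMod (2 * m + 1))).val ≤ m
        then (1 : ℤ) else -1) = if j ≤ m then 1 else -1 := by
    intro j hj
    have : ((j : ZMod (2 * m + 1))).val = j := ZMod.val_natCast_of_lt (by simpa using hj)
    simp [this]
  rw [Finset.sum_congr rfl h, show 2 * m + 1 = (m + 1) + m by ring, Finset.sum_range_add]
  have h1 : ∀ j ∈ Finset.range (m + 1), (if j ≤ m then (1 : ℤ) else -1) = 1 := by
    intro j hj
    rw [if_pos (by simpa [Nat.lt_succ_iff] using hj)]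
  have h2 : ∀ j ∈ Finset.range m, (if m + 1 + j ≤ m then (1 : ℤ) else -1) = -1 := by
    intro j _
    rw [if_neg (by omega)]
  rw [Finset.sum_congr rfl h1, Finset.sum_congr rfl h2]
  simp

/-- The `q` points fall into distinct mesh intervals, since `p` is a unit mod `q`. The initial
offset and the drift, each at most a quarter of the mesh, keep them in the left halves. So the sum
is that of `m + 1` plus signs and `m` minus signs. -/
theorem sum_rotationStep_eq_one {q m p : ℕ} (hq : q = 2 * m + 1) (hp : p.Coprime q) {ε : ℝ}
    (hε : 0 ≤ ε) (hqε : q * (q * ε) ≤ 1 / 4) {t : ℝ} (ht : Int.fract (q * t) < 1 / 4) :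
    ∑ j ∈ Finset.range q, rotationStep (t + j * (p / q + ε)) = 1 := by
  have hq0 : (0 : ℝ) < q := by rw [hq]; positivity
  have : NeZero q := ⟨by omega⟩
  have hterm : ∀ j ∈ Finset.range q, rotationStep (t + j * (p / q + ε)) =
      (fun z : ZMod q => if z.val ≤ m then (1 : ℤ) else -1)
        ((⌊q * t⌋ : ZMod q) + j * (ZMod.unitOfCoprime p hp)) := by
    intro j hj
    have hjq : (j : ℝ) ≤ q := by
      have := Finset.mem_range.1 hj
      exact_mod_cast this.le
    have hr0 : 0 ≤ Int.fract (q * t) + q * (j * ε) := by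
      have := Int.fract_nonneg (q * t); positivity
    have hr1 : Int.fract (q * t) + q * (j * ε) < 1 / 2 := by
      have : (q : ℝ) * (j * ε) ≤ q * (q * ε) := by gcongr
      linarith
    have key := rotationStep_div hq (⌊q * t⌋ + j * p) hr0 hr1
    have harg : (((⌊q * t⌋ + j * p : ℤ) : ℝ) + (Int.fract (q * t) + q * (j * ε))) / q
        = t + j * (p / q + ε) := by
      have := Int.floor_add_fract (q * t)
      rw [div_eq_iff hq0.ne']
      push_cast
      field_simp
      linarith
    rw [harg] at key
    rw [key]
    push_cast [ZMod.coe_unitOfCoprime]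
    rfl
  subst hq
  rw [Finset.sum_congr rfl hterm]
  exact (sum_range_zmod_affine (ZMod.unitOfCoprime p hp) _
    (fun z : ZMod (2 * m + 1) => if z.val ≤ m then (1 : ℤ) else -1)).trans (sum_zmod_half m)

theorem tendsto_measure_symmDiff_add_right {E : Set UnitAddCircle} (hE : MeasurableSet E) :
    Tendsto (fun s : UnitAddCircle => volume (((fun y => y + s) ⁻¹' E) ∆ E)) (𝓝 0) (𝓝 0) := by
  -- Currying addition turns the translations into a family that is continuous for the compact-open
  -- topology.
  let F : C(UnitAddCircle, C(UnitAddCircle, UnitAddCircle)) :=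
    ContinuousMap.curry ⟨fun z : UnitAddCircle × UnitAddCircle => z.2 + z.1, by fun_prop⟩
  have h := tendsto_measure_symmDiff_preimage_nhds_zero (μ := (volume : Measure UnitAddCircle))
    (ν := volume) (f := F) (g := F 0) (F.continuous.tendsto 0)
    (Eventually.of_forall fun s => measurePreserving_add_right volume s)
    (measurePreserving_add_right volume 0) hE.nullMeasurableSet (measure_ne_top _ _)
  refine h.congr fun s => ?_
  have h0 : (F 0 : UnitAddCircle → UnitAddCircle) ⁻¹' E = E := by
    ext y; simp [F]
  rw [h0]
  rfl

/-! ### Invariant sets of the skew product, given by their slices `B n`. -/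

section Extension

variable {B : ℤ → Set UnitAddCircle}

theorem mem_iterate_rotation
    (hB : ∀ (n : ℤ) (t : ℝ), ((t : ℝ) : UnitAddCircle) ∈ B n ↔
      ((t + rotationAngle : ℝ) : UnitAddCircle) ∈ B (n + rotationStep t)) (q : ℕ) (n : ℤ) (t : ℝ) :
    (t : UnitAddCircle) ∈ B n ↔ ((t + q * rotationAngle : ℝ) : UnitAddCircle) ∈
      B (n + ∑ j ∈ Finset.range q, rotationStep (t + j * rotationAngle)) := by
  induction q with
  | zero => simp
  | succ q ih =>
    rw [ih, hB, Finset.sum_range_succ]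
    push_cast
    rw [show t + q * rotationAngle + rotationAngle = t + (q + 1) * rotationAngle by ring, add_assoc]

/-- Where the sum is `1`, the `q`-th iterate sends slice `n` into slice `n + 1` while translating by
`q * α`; a point of `B n \ B (n + 1)` there is moved into `B (n + 1)` from outside. These points
fill only the quarter `D` of the circle, but four translates of `D` cover it, and such short
translations hardly change `B n \ B (n + 1)`. -/
theorem measure_sdiff_le_of_sum_eq_one
    (hB : ∀ (n : ℤ) (t : ℝ), ((t : ℝ) : UnitAddCircle) ∈ B n ↔
      ((t + rotationAngle : ℝ) : UnitAddCircle) ∈ B (n + rotationStep t)) {q : ℕ} (hq : 0 < q)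
    (hsum : ∀ t : ℝ, Int.fract (q * t) < 1 / 4 →
      ∑ j ∈ Finset.range q, rotationStep (t + j * rotationAngle) = 1) (n : ℤ) :
    volume (B n \ B (n + 1)) ≤ ∑ i ∈ Finset.range 4,
      (volume (((fun y => y + ((i / (4 * q) : ℝ) : UnitAddCircle)) ⁻¹' (B n \ B (n + 1))) ∆
          (B n \ B (n + 1))) +
        volume (((fun y => y + ((q * rotationAngle : ℝ) : UnitAddCircle)) ⁻¹' (B (n + 1))) ∆
          (B (n + 1)))) := by
  set E := B n \ B (n + 1) with hE
  have hq0 : (0 : ℝ) < q := by exact_mod_cast hq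
  let D : Set UnitAddCircle := {y | ∃ t : ℝ, (t : UnitAddCircle) = y ∧ Int.fract (q * t) < 1 / 4}
  have hcover : E ⊆ ⋃ i ∈ Finset.range 4,
      ((((fun y => y + ((i / (4 * q) : ℝ) : UnitAddCircle)) ⁻¹' E) ∆ E) ∪
        ((fun y => y + ((i / (4 * q) : ℝ) : UnitAddCircle)) ⁻¹' (E ∩ D))) := by
    intro y hy
    obtain ⟨t, rfl⟩ := QuotientAddGroup.mk_surjective y
    obtain ⟨i, hi, hfr⟩ : ∃ i ∈ Finset.range 4, Int.fract (q * (t + i / (4 * q))) < 1 / 4 := by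
      have hexp : ∀ i : ℕ, (q : ℝ) * (t + i / (4 * q)) = q * t + i / 4 := by
        intro i; field_simp
      simp only [hexp]
      have h0 := Int.fract_nonneg (q * t)
      have h1 := Int.fract_lt_one (q * t)
      have hfl := Int.floor_add_fract (q * t)
      -- Translation by `i / (4 * q)` adds `i` quarters to the fractional part; `j` is the carry.
      have key : ∀ (i : ℕ) (j : ℤ), 0 ≤ Int.fract (q * t) + i / 4 - j →
          Int.fract (q * t) + i / 4 - j < 1 / 4 → Int.fract (q * t + i / 4) < 1 / 4 := by
        intro i j hl hr
        have : Int.fract (q * t + i / 4) = Int.fract (q * t) + i / 4 - j := by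
          rw [Int.fract_eq_iff]
          refine ⟨hl, by linarith, ⌊q * t⌋ + j, ?_⟩
          push_cast
          linarith
        rwa [this]
      rcases lt_or_ge (Int.fract (q * t)) (1 / 4) with h | h
      · exact ⟨0, by simp, key 0 0 (by push_cast; linarith) (by push_cast; linarith)⟩
      rcases lt_or_ge (Int.fract (q * t)) (2 / 4) with h' | h'
      · exact ⟨3, by simp, key 3 1 (by push_cast; linarith) (by push_cast; linarith)⟩
      rcases lt_or_ge (Int.fract (q * t)) (3 / 4) with h'' | h''
      · exact ⟨2, by simp, key 2 1 (by push_cast; linarith) (by push_cast; linarith)⟩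
      · exact ⟨1, by simp, key 1 1 (by push_cast; linarith) (by push_cast; linarith)⟩
    rw [Set.mem_iUnion₂]
    refine ⟨i, hi, ?_⟩
    by_cases h : (t : UnitAddCircle) + ((i / (4 * q) : ℝ) : UnitAddCircle) ∈ E
    · exact Or.inr ⟨h, t + i / (4 * q), by rw [AddCircle.coe_add], hfr⟩
    · exact Or.inl (Or.inr ⟨hy, h⟩)
  have hED : E ∩ D ⊆
      ((fun y => y + ((q * rotationAngle : ℝ) : UnitAddCircle)) ⁻¹' (B (n + 1))) ∆ (B (n + 1)) := by
    rintro y ⟨⟨hy, hy'⟩, t, rfl, ht⟩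
    refine Or.inl ⟨?_, hy'⟩
    have := (mem_iterate_rotation hB q n t).1 hy
    rw [hsum t ht, AddCircle.coe_add] at this
    exact this
  calc volume E ≤ _ := measure_mono hcover
    _ ≤ _ := measure_biUnion_finset_le _ _
    _ ≤ _ := Finset.sum_le_sum fun i _ => (measure_union_le _ _).trans ?_
  refine add_le_add le_rfl ?_
  rw [measure_preimage_add_right]
  exact measure_mono hED

/-- Along `q = 3 ^ k!` both translations in the previous bound tend to zero on the circle: `i / (4 *
q)` because `q → ∞`, and `q * α = p + q * ε` because the integer `p` vanishes there. -/
theorem measure_sdiff_succ_eq_zero (hBm : ∀ n, MeasurableSet (B n))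
    (hB : ∀ (n : ℤ) (t : ℝ), ((t : ℝ) : UnitAddCircle) ∈ B n ↔
      ((t + rotationAngle : ℝ) : UnitAddCircle) ∈ B (n + rotationStep t)) (n : ℤ) :
    volume (B n \ B (n + 1)) = 0 := by
  let Q : ℕ → ℕ := fun k => 3 ^ k.factorial
  have hQcast : ∀ k, (Q k : ℝ) = (3 : ℝ) ^ k.factorial := fun k => by simp [Q]
  have hQtop : Tendsto (fun k => (Q k : ℝ)) atTop atTop := by
    simp only [hQcast]
    refine (tendsto_pow_atTop_atTop_of_one_lt (by norm_num : (1 : ℝ) < 3)).comp ?_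
    exact tendsto_atTop_mono (fun k => Nat.self_le_factorial k) tendsto_id
  have hsmall : ∀ i : ℕ, Tendsto (fun k => ((i / (4 * Q k) : ℝ) : UnitAddCircle)) atTop (𝓝 0) := by
    intro i
    have : Tendsto (fun k => (i / (4 * Q k) : ℝ)) atTop (𝓝 0) :=
      Tendsto.const_div_atTop (hQtop.const_mul_atTop (by norm_num)) _
    exact (AddCircle.continuous_mk' 1).tendsto' 0 0 rfl |>.comp this
  have hang : Tendsto (fun k => ((Q k * rotationAngle : ℝ) : UnitAddCircle)) atTop (𝓝 0) := by
    choose! p ε hp hε hle heq using exists_rotationAngle_eq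
    have h1 : Tendsto (fun k => (Q k : ℝ) * ε k) atTop (𝓝 0) := by
      refine tendsto_of_tendsto_of_tendsto_of_le_of_le' tendsto_const_nhds
        (tendsto_inv_atTop_zero.comp hQtop) ?_ ?_
      · filter_upwards [eventually_ge_atTop 3] with k hk
        have := hε k hk
        positivity
      · filter_upwards [eventually_ge_atTop 3] with k hk
        have hQ1 : (1 : ℝ) ≤ Q k := by rw [hQcast]; exact one_le_pow₀ (by norm_num)
        have h := hle k hk
        rw [← hQcast] at h
        have h0 : 0 ≤ (Q k : ℝ) * ε k := by have := hε k hk; positivity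
        simp only [Function.comp, ← one_div]
        nlinarith
    have h2 := (AddCircle.continuous_mk' (1 : ℝ)).tendsto' 0 0 rfl |>.comp h1
    refine h2.congr' ?_
    filter_upwards [eventually_ge_atTop 3] with k hk
    have hQ0 : (Q k : ℝ) ≠ 0 := by rw [hQcast]; positivity
    have : (Q k : ℝ) * rotationAngle = p k + Q k * ε k := by
      rw [heq k hk, ← hQcast]
      field_simp
    rw [this, AddCircle.coe_add]
    have hpk : ((p k : ℝ) : UnitAddCircle) = 0 := by
      rw [AddCircle.coe_eq_zero_iff]
      exact ⟨p k, by simp⟩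
    rw [hpk, zero_add]
    rfl
  set E := B n \ B (n + 1) with hE
  have hEm : MeasurableSet E := (hBm n).diff (hBm _)
  have hlim : Tendsto (fun k => ∑ i ∈ Finset.range 4,
      (volume (((fun y => y + ((i / (4 * Q k) : ℝ) : UnitAddCircle)) ⁻¹' E) ∆ E) +
        volume (((fun y => y + ((Q k * rotationAngle : ℝ) : UnitAddCircle)) ⁻¹' (B (n + 1))) ∆
          (B (n + 1))))) atTop (𝓝 (∑ i ∈ Finset.range 4, (0 + 0))) :=
    tendsto_finsetSum _ fun i _ =>
      ((tendsto_measure_symmDiff_add_right hEm).comp (hsmall i)).add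
        ((tendsto_measure_symmDiff_add_right (hBm _)).comp hang)
  refine le_antisymm ?_ zero_le
  refine (ge_of_tendsto hlim ?_).trans (by simp)
  filter_upwards [eventually_ge_atTop 3] with k hk
  obtain ⟨p, ε, hp, hε, hle, heq⟩ := exists_rotationAngle_eq k hk
  obtain ⟨m, hm⟩ : Odd (Q k) := Odd.pow (by decide)
  refine measure_sdiff_le_of_sum_eq_one hB (by positivity) (fun t ht => ?_) n
  rw [heq, ← hQcast]
  refine sum_rotationStep_eq_one hm hp hε ?_ ht
  rw [← hQcast] at hle
  refine hle.trans ?_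
  have : (4 : ℝ) ≤ Q k := by
    rw [hQcast]
    calc (4 : ℝ) ≤ 3 ^ 3 := by norm_num
      _ ≤ _ := pow_le_pow_right₀ (by norm_num) (hk.trans (Nat.self_le_factorial k))
  gcongr

/-- The integer extension of the irrational rotation by `rotationStep` is ergodic. -/
theorem rotation_extension_ergodic (hBm : ∀ n, MeasurableSet (B n))
    (hB : ∀ (n : ℤ) (t : ℝ), ((t : ℝ) : UnitAddCircle) ∈ B n ↔
      ((t + rotationAngle : ℝ) : UnitAddCircle) ∈ B (n + rotationStep t)) :
    (∀ n, volume (B n) = 0) ∨ (∀ n, volume (B n)ᶜ = 0) := by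
  have hsucc : ∀ n, B n =ᵐ[volume] B (n + 1) := by
    intro n
    have h1 := measure_sdiff_succ_eq_zero hBm hB n
    -- The complements are also slices of an invariant set, which gives the reverse inclusion.
    have h2 := measure_sdiff_succ_eq_zero (B := fun n => (B n)ᶜ) (fun n => (hBm n).compl)
      (fun n t => not_congr (hB n t)) n
    rw [compl_sdiff_compl] at h2
    exact (ae_le_set.2 h1).antisymm (ae_le_set.2 h2)
  have hall : ∀ n, B n =ᵐ[volume] B 0 := by
    intro n
    induction n with
    | zero => rfl
    | succ n ih => exact (hsucc n).symm.trans ih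
    | pred n ih =>
      have := hsucc (-(n : ℤ) - 1)
      rw [sub_add_cancel] at this
      exact this.trans ih
  have herg : Ergodic (fun y : UnitAddCircle => y + (rotationAngle : UnitAddCircle)) volume := by
    rw [AddCircle.ergodic_add_right]
    refine addOrderOf_eq_zero ?_
    intro hfin
    obtain ⟨n, hn, h⟩ := isOfFinAddOrder_iff_nsmul_eq_zero.1 hfin
    rw [← AddCircle.coe_nsmul, AddCircle.coe_eq_zero_iff] at h
    obtain ⟨z, hz⟩ := h
    refine irrational_rotationAngle ⟨z / n, ?_⟩
    simp only [zsmul_eq_mul, nsmul_eq_mul, mul_one] at hz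
    push_cast
    rw [hz]
    field_simp
  have hqmp := herg.toMeasurePreserving.quasiMeasurePreserving
  -- The skew product sends `B 0` into slice `1` or `-1`; as all slices agree almost everywhere, the
  -- level can be forgotten.
  have hinv : (fun y : UnitAddCircle => y + (rotationAngle : UnitAddCircle)) ⁻¹' (B 0)
      =ᵐ[volume] B 0 := by
    have h1 := hqmp.preimage_ae_eq (hall 1)
    have h2 := hqmp.preimage_ae_eq (hall (-1))
    filter_upwards [h1, h2] with y h1 h2
    obtain ⟨t, rfl⟩ := QuotientAddGroup.mk_surjective y
    have h := hB 0 t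
    rw [AddCircle.coe_add, zero_add] at h
    refine propext (Iff.trans ?_ h.symm)
    unfold rotationStep
    split_ifs
    · exact (iff_of_eq h1).symm
    · exact (iff_of_eq h2).symm
  rcases herg.quasiErgodic.ae_empty_or_univ₀ (hBm 0).nullMeasurableSet hinv with h | h
  · left
    intro n
    exact ae_eq_empty.1 ((hall n).trans h)
  · right
    intro n
    exact ae_eq_univ.1 ((hall n).trans h)

end Extension

/-! ### Towers over the integer extension, on the line -/

/-- An injective and surjective map of the line that has countably many displacements preserves
Lebesgue measure. -/
theorem measurePreserving_of_countable_displacement {f : ℝ → ℝ} (hf : Measurable f)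
    (hbij : Function.Bijective f) {D : Set ℝ} (hD : D.Countable) (hfD : ∀ t, f t - t ∈ D) :
    MeasurePreserving f volume volume := by
  refine ⟨hf, Measure.ext fun A hA => ?_⟩
  rw [Measure.map_apply hf hA]
  have : Countable D := hD.to_subtype
  -- `Q d` collects the points reached with displacement `d`. Bijectivity makes these sets a
  -- countable partition, and on each of them the inverse map is a translation.
  let Q : D → Set ℝ := fun d => {s | f (s - d) = s}
  have hQm : ∀ d, MeasurableSet (Q d) := fun d =>
    measurableSet_eq_fun (hf.comp (measurable_id.sub_const _)) measurable_id
  have h1 : A = ⋃ d, A ∩ Q d := by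
    rw [← Set.inter_iUnion, eq_comm, Set.inter_eq_left]
    intro s _
    obtain ⟨t, rfl⟩ := hbij.2 s
    exact Set.mem_iUnion.2 ⟨⟨f t - t, hfD t⟩, by simp [Q]⟩
  have h2 : f ⁻¹' A = ⋃ d : D, (fun t => t + (d : ℝ)) ⁻¹' (A ∩ Q d) := by
    ext t
    simp only [Set.mem_preimage, Set.mem_iUnion, Set.mem_inter_iff, Q, Set.mem_ofPred_eq,
      add_sub_cancel_right]
    constructor
    · intro h
      exact ⟨⟨f t - t, hfD t⟩, by simpa using h, by simp⟩
    · rintro ⟨d, h, h'⟩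
      rwa [h']
  have hdisj : Pairwise (Function.onFun Disjoint fun d => A ∩ Q d) := by
    intro d d' hdd'
    refine Set.disjoint_left.2 fun s hs hs' => hdd' ?_
    have := hbij.1 (hs.2.trans hs'.2.symm)
    exact Subtype.ext (by linarith)
  have hdisj' : Pairwise (Function.onFun Disjoint
      fun d : D => (fun t => t + (d : ℝ)) ⁻¹' (A ∩ Q d)) := by
    intro d d' hdd'
    refine Set.disjoint_left.2 fun s hs hs' => hdd' ?_
    have h := hs.2
    have h' := hs'.2
    simp only [Q, Set.mem_ofPred_eq, add_sub_cancel_right] at h h'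
    exact Subtype.ext (by linarith)
  rw [h2, measure_iUnion hdisj' fun d => (hA.inter (hQm d)).preimage (measurable_add_const _)]
  conv_rhs => rw [h1, measure_iUnion hdisj fun d => hA.inter (hQm d)]
  exact tsum_congr fun d => measure_preimage_add_right _ _ _

theorem volume_preimage_coe_unitAddCircle {B : Set UnitAddCircle} (hB : MeasurableSet B)
    (h0 : volume B = 0) : volume ((fun t : ℝ => (t : UnitAddCircle)) ⁻¹' B) = 0 := by
  set E : Set ℝ := (fun t : ℝ => (t : UnitAddCircle)) ⁻¹' B with hE
  have hEm : MeasurableSet E := AddCircle.measurable_mk' hB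
  have hk : ∀ k : ℤ, volume (E ∩ Set.Ioc (k : ℝ) (k + 1)) = 0 := by
    intro k
    have := (UnitAddCircle.measurePreserving_mk (k : ℝ)).measure_preimage hB.nullMeasurableSet
    rw [Measure.restrict_apply (AddCircle.measurable_mk' hB), h0] at this
    exact this
  refine measure_mono_null (t := ⋃ k : ℤ, E ∩ Set.Ioc (k : ℝ) (k + 1)) ?_ (measure_iUnion_null hk)
  rw [← Set.inter_iUnion, iUnion_Ioc_intCast, Set.inter_univ]

theorem volume_affine_preimage_null {E : Set ℝ} (hE : volume E = 0) (a : ℝ) {u : ℝ} (hu : 0 < u) :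
    volume ((fun t : ℝ => (t - a) / u) ⁻¹' E) = 0 := by
  have h : (fun t : ℝ => (t - a) / u) ⁻¹' E
      = (fun t => t + -a) ⁻¹' ((fun t => t * u⁻¹) ⁻¹' E) := by
    ext t; simp [div_eq_mul_inv, sub_eq_add_neg]
  rw [h, measure_preimage_add_right, Real.volume_preimage_mul_right (inv_ne_zero hu.ne'), hE,
    mul_zero]

theorem rotationStep_fract (t : ℝ) : rotationStep (Int.fract t) = rotationStep t := by
  simp [rotationStep]

theorem rotationStep_add_one (t : ℝ) : rotationStep (t + 1) = rotationStep t := by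
  simp [rotationStep]

theorem fract_fract_add (t a : ℝ) : Int.fract (Int.fract t + a) = Int.fract (t + a) := by
  rw [Int.fract_eq_fract]
  exact ⟨-⌊t⌋, by have := Int.floor_add_fract t; push_cast; linarith⟩

/-- `S` is the tower with base the integer extension of the rotation, with cells
`[c n, c (n + 1))` and unit of length `u`. -/
structure IsTowerMap (c : ℤ → ℝ) (u : ℝ) (S : ℝ → ℝ) : Prop where
  pos : 0 < u
  le_length : ∀ n, u ≤ c (n + 1) - c n
  length_le : ∀ n, c (n + 1) - c n ≤ 2 * u
  up : ∀ n s, 0 ≤ s → s + u < c (n + 1) - c n → S (c n + s) = c n + (s + u)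
  jump : ∀ n s, 0 ≤ s → s < c (n + 1) - c n → c (n + 1) - c n ≤ s + u →
    S (c n + s) = c (n + rotationStep (s / u)) + u * Int.fract (s / u + rotationAngle)

namespace IsTowerMap

variable {c : ℤ → ℝ} {u : ℝ} {S : ℝ → ℝ}

theorem exists_cell (hu : 0 < u) (h : ∀ n, u ≤ c (n + 1) - c n) (t : ℝ) :
    ∃ n s, t = c n + s ∧ 0 ≤ s ∧ s < c (n + 1) - c n := by
  have hup : ∀ n : ℕ, c 0 + n * u ≤ c n := by
    intro n
    induction n with
    | zero => simp
    | succ n ih => have := h n; push_cast; linarith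
  have hdown : ∀ n : ℕ, c (-n) ≤ c 0 - n * u := by
    intro n
    induction n with
    | zero => simp
    | succ n ih =>
      have := h (-(n : ℤ) - 1)
      rw [sub_add_cancel] at this
      push_cast
      rw [show -((n : ℤ) + 1) = -(n : ℤ) - 1 by ring]
      linarith
  have hmono : StrictMono c := strictMono_int_of_lt_succ fun n => by have := h n; linarith
  obtain ⟨N, hN⟩ := exists_nat_gt ((t - c 0) / u)
  obtain ⟨M, hM⟩ := exists_nat_gt ((c 0 - t) / u)
  rw [div_lt_iff₀ hu] at hN hM
  obtain ⟨n, hn, hmax⟩ := Int.exists_greatest_of_bdd (P := fun n => c n ≤ t)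
    ⟨N, fun z hz => by
      by_contra! hlt
      have := hmono hlt
      have := hup N
      linarith⟩ ⟨-M, by have := hdown M; linarith⟩
  refine ⟨n, t - c n, by ring, by linarith, ?_⟩
  by_contra! hlt
  have := hmax (n + 1) (by linarith)
  omega

theorem cell_unique (hu : 0 < u) (h : ∀ n, u ≤ c (n + 1) - c n) {n m : ℤ} {s r : ℝ} (hs : 0 ≤ s)
    (hs' : s < c (n + 1) - c n) (hr : 0 ≤ r) (hr' : r < c (m + 1) - c m)
    (heq : c n + s = c m + r) : n = m ∧ s = r := by
  have hmono : StrictMono c := strictMono_int_of_lt_succ fun n => by have := h n; linarith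
  have hnm : n = m := by
    rcases lt_trichotomy n m with hlt | rfl | hlt
    · have := hmono.monotone (show n + 1 ≤ m from hlt)
      linarith
    · rfl
    · have := hmono.monotone (show m + 1 ≤ n from hlt)
      linarith
  subst hnm
  exact ⟨rfl, by linarith⟩

variable (h : IsTowerMap c u S)

include h

theorem exists_target (n : ℤ) (s : ℝ) (hs : 0 ≤ s) (hs' : s < c (n + 1) - c n) :
    ∃ m r, S (c n + s) = c m + r ∧ 0 ≤ r ∧ r < c (m + 1) - c m ∧
      ((s + u < c (n + 1) - c n ∧ m = n ∧ r = s + u) ∨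
      (c (n + 1) - c n ≤ s + u ∧ m = n + rotationStep (s / u) ∧
        r = u * Int.fract (s / u + rotationAngle))) := by
  have hu := h.pos
  rcases lt_or_ge (s + u) (c (n + 1) - c n) with h1 | h1
  · exact ⟨n, s + u, h.up n s hs h1, by positivity, h1, Or.inl ⟨h1, rfl, rfl⟩⟩
  · refine ⟨_, _, h.jump n s hs hs' h1, ?_, ?_, Or.inr ⟨h1, rfl, rfl⟩⟩
    · have := Int.fract_nonneg (s / u + rotationAngle); positivity
    · have h2 := h.le_length (n + rotationStep (s / u))
      have := Int.fract_lt_one (s / u + rotationAngle)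
      nlinarith

/-- Climbing lands at offset at least `u` and jumping at offset below `u`, so the two never collide.
For two jumps with the same target, the offsets agree modulo `u`, hence have the same sign and the
same cell; both lie in the top stretch of length `u`, so they coincide. -/
theorem injective : Function.Injective S := by
  intro t t' htt'
  have hu := h.pos
  obtain ⟨n, s, rfl, hs, hs'⟩ := exists_cell h.pos h.le_length t
  obtain ⟨n', s', rfl, hr, hr'⟩ := exists_cell h.pos h.le_length t'
  obtain ⟨m, r, hS, h0, h1, hor⟩ := h.exists_target n s hs hs'
  obtain ⟨m', r', hS', h0', h1', hor'⟩ := h.exists_target n' s' hr hr'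
  obtain ⟨rfl, rfl⟩ := cell_unique h.pos h.le_length h0 h1 h0' h1' (by rw [← hS, ← hS', htt'])
  have hlt : ∀ x : ℝ, u * Int.fract x < u := fun x => by
    have := Int.fract_lt_one x; nlinarith
  rcases hor with ⟨h2, rfl, rfl⟩ | ⟨h2, hm, hr2⟩ <;> rcases hor' with ⟨h3, h4, h5⟩ | ⟨h3, h4, h5⟩
  · subst h4
    rw [show s = s' by linarith]
  · have := hlt (s' / u + rotationAngle)
    linarith
  · have := hlt (s / u + rotationAngle)
    linarith
  · have hfr : Int.fract (s / u + rotationAngle) = Int.fract (s' / u + rotationAngle) :=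
      mul_left_cancel₀ hu.ne' (hr2.symm.trans h5)
    obtain ⟨z, hz⟩ := Int.fract_eq_fract.1 hfr
    have hz' : s / u - s' / u = z := by linarith
    have hstep : rotationStep (s / u) = rotationStep (s' / u) := by
      rw [← rotationStep_fract (s / u), ← rotationStep_fract (s' / u),
        Int.fract_eq_fract.2 ⟨z, hz'⟩]
    have hn : n = n' := by rw [hstep] at hm; omega
    subst hn
    have hsu : s - s' = z * u := by
      rw [← sub_div, div_eq_iff hu.ne'] at hz'
      exact hz'
    have hz1 : z < 1 := by
      by_contra! hge
      have : (1 : ℝ) ≤ z := by exact_mod_cast hge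
      nlinarith
    have hz2 : -1 < z := by
      by_contra! hge
      have : (z : ℝ) ≤ -1 := by exact_mod_cast hge
      nlinarith
    have hz0 : z = 0 := by omega
    rw [hz0, Int.cast_zero, zero_mul] at hsu
    rw [show s = s' by linarith]

theorem surjective : Function.Surjective S := by
  intro t
  have hu := h.pos
  obtain ⟨n, s, rfl, hs, hs'⟩ := exists_cell h.pos h.le_length t
  rcases le_or_gt u s with hus | hus
  · refine ⟨c n + (s - u), ?_⟩
    rw [h.up n (s - u) (by linarith) (by linarith)]
    ring
  · set y := Int.fract (s / u - rotationAngle) with hy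
    have hy0 : 0 ≤ y := Int.fract_nonneg _
    have hy1 : y < 1 := Int.fract_lt_one _
    have hfy : Int.fract (y + rotationAngle) = s / u := by
      rw [hy, fract_fract_add, sub_add_cancel, Int.fract_eq_self]
      exact ⟨by positivity, by rwa [div_lt_one hu]⟩
    set m := n - rotationStep y with hm
    have hl := h.le_length m
    have hl' := h.length_le m
    have huy : u * y < u := by nlinarith
    have huy0 : 0 ≤ u * y := by positivity
    -- The preimage is the highest point of cell `m` over the base point `u * y`: on the second
    -- floor if that floor reaches so far, otherwise on the first.
    rcases lt_or_ge (u * y + u) (c (m + 1) - c m) with h1 | h1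
    · refine ⟨c m + (u * y + u), ?_⟩
      rw [h.jump m (u * y + u) (by linarith) h1 (by linarith)]
      have : (u * y + u) / u = y + 1 := by field_simp
      rw [this, rotationStep_add_one, show y + 1 + rotationAngle = y + rotationAngle + 1 by ring,
        Int.fract_add_one, hfy, hm, sub_add_cancel, mul_div_cancel₀ _ hu.ne']
    · refine ⟨c m + u * y, ?_⟩
      rw [h.jump m (u * y) huy0 (by linarith) h1, mul_div_cancel_left₀ _ hu.ne',
        hfy, hm, sub_add_cancel, mul_div_cancel₀ _ hu.ne']

theorem measurePreserving (hS : Measurable S) : MeasurePreserving S volume volume := by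
  have hu := h.pos
  refine measurePreserving_of_countable_displacement hS ⟨h.injective, h.surjective⟩
    (D := Set.range (fun z : ℤ × ℤ × ℤ => c z.1 - c z.2.1 + u * (rotationAngle - z.2.2)) ∪ {u})
    ((Set.countable_range _).union (Set.countable_singleton _)) fun t => ?_
  obtain ⟨n, s, rfl, hs, hs'⟩ := exists_cell h.pos h.le_length t
  rcases lt_or_ge (s + u) (c (n + 1) - c n) with h1 | h1
  · right
    rw [h.up n s hs h1]
    exact (by ring : c n + (s + u) - (c n + s) = u)
  -- In a jump the offset `s` cancels from the displacement, which leaves only integer parameters.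
  · left
    refine ⟨(n + rotationStep (s / u), n, ⌊s / u + rotationAngle⌋), ?_⟩
    rw [h.jump n s hs hs' h1, Int.fract]
    field_simp
    ring

theorem abs_sub_le (t : ℝ) : |S t - t| ≤ 4 * u := by
  have hu := h.pos
  obtain ⟨n, s, rfl, hs, hs'⟩ := exists_cell h.pos h.le_length t
  have hl := h.length_le n
  rcases lt_or_ge (s + u) (c (n + 1) - c n) with h1 | h1
  · rw [h.up n s hs h1, abs_le]
    constructor <;> linarith
  · rw [h.jump n s hs hs' h1, abs_le]
    have h2 := Int.fract_lt_one (s / u + rotationAngle)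
    have h3 : 0 ≤ u * Int.fract (s / u + rotationAngle) := by
      have := Int.fract_nonneg (s / u + rotationAngle); positivity
    have h4 : u * Int.fract (s / u + rotationAngle) ≤ u := by nlinarith
    have h5 := h.le_length (n - 1)
    have h6 := h.length_le (n - 1)
    rw [sub_add_cancel] at h5 h6
    unfold rotationStep
    split_ifs
    · constructor <;> linarith
    -- The extreme case behind the constant `4`: the point may be `2 * u` above the start of its
    -- cell, and the previous cell may have length `2 * u`.
    · rw [← sub_eq_add_neg]
      constructor <;> linarith

/-- The traces of an invariant set on the bottoms of the cells are invariant under the extension of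
the rotation. -/
theorem base_invariant {A : Set ℝ} (hA : S ⁻¹' A = A) (n : ℤ) (t : ℝ) :
    c n + u * Int.fract t ∈ A ↔
      c (n + rotationStep t) + u * Int.fract (t + rotationAngle) ∈ A := by
  have hu := h.pos
  have hA' : ∀ x, S x ∈ A ↔ x ∈ A := fun x => by
    rw [← Set.mem_preimage, hA]
  have hl := h.le_length n
  have hl' := h.length_le n
  have hy1 : u * Int.fract t < u := by have := Int.fract_lt_one t; nlinarith
  have hy0 : 0 ≤ u * Int.fract t := by have := Int.fract_nonneg t; positivity
  rcases lt_or_ge (u * Int.fract t + u) (c (n + 1) - c n) with h1 | h1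
  · have e1 := h.up n _ hy0 h1
    have e2 := h.jump n (u * Int.fract t + u) (by linarith) h1 (by linarith)
    have : (u * Int.fract t + u) / u = Int.fract t + 1 := by field_simp
    rw [this, rotationStep_add_one, rotationStep_fract,
      show Int.fract t + 1 + rotationAngle = Int.fract t + rotationAngle + 1 by ring,
      Int.fract_add_one, fract_fract_add] at e2
    rw [← hA', e1, ← hA', e2]
  · have e := h.jump n _ hy0 (by linarith) h1
    rw [mul_div_cancel_left₀ _ hu.ne', rotationStep_fract, fract_fract_add] at e
    rw [← hA', e]

/-- A point of the second floor is the image under `S` of the point below it. -/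
theorem mem_iff_base {A : Set ℝ} (hA : S ⁻¹' A = A) (n : ℤ) (s : ℝ) (hs : 0 ≤ s)
    (hs' : s < c (n + 1) - c n) : c n + s ∈ A ↔ c n + u * Int.fract (s / u) ∈ A := by
  have hu := h.pos
  have hl' := h.length_le n
  rcases lt_or_ge s u with h1 | h1
  · rw [Int.fract_eq_self.2 ⟨by positivity, by rwa [div_lt_one hu]⟩, mul_div_cancel₀ _ hu.ne']
  · have e := h.up n (s - u) (by linarith) (by linarith)
    have : s / u = (s - u) / u + 1 := by field_simp; ring
    rw [this, Int.fract_add_one,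
      Int.fract_eq_self.2 ⟨div_nonneg (by linarith) hu.le, by rw [div_lt_one hu]; linarith⟩,
      mul_div_cancel₀ _ hu.ne']
    conv_rhs => rw [← hA, Set.mem_preimage, e]
    simp

theorem volume_eq_zero_of_base {A : Set ℝ} (hA : S ⁻¹' A = A) {B : ℤ → Set UnitAddCircle}
    (hBm : ∀ n, MeasurableSet (B n))
    (hB : ∀ (n : ℤ) (t : ℝ), c n + u * Int.fract t ∈ A → (t : UnitAddCircle) ∈ B n)
    (h0 : ∀ n, volume (B n) = 0) : volume A = 0 := by
  refine measure_mono_null (t := ⋃ n : ℤ, (fun t : ℝ => (t - c n) / u) ⁻¹'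
    ((fun t : ℝ => (t : UnitAddCircle)) ⁻¹' B n)) ?_ (measure_iUnion_null fun n =>
      volume_affine_preimage_null (volume_preimage_coe_unitAddCircle (hBm n) (h0 n)) _ h.pos)
  intro t ht
  obtain ⟨n, s, rfl, hs, hs'⟩ := exists_cell h.pos h.le_length t
  refine Set.mem_iUnion.2 ⟨n, ?_⟩
  simp only [Set.mem_preimage, add_sub_cancel_left]
  exact hB n _ ((h.mem_iff_base hA n s hs hs').1 ht)

/-- The traces of an invariant set on the cell bottoms, read on the circle, are slices of an
invariant set of the skew product. They determine the whole set up to countably many affine copies,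
so null or conull slices suffice. -/
theorem ergodic (hS : Measurable S) : Ergodic S volume := by
  refine ⟨h.measurePreserving hS, ⟨fun A hAm hA => ?_⟩⟩
  let rep : UnitAddCircle → ℝ := fun y => (AddCircle.equivIco 1 0 y : ℝ)
  have hrep : Measurable rep :=
    measurable_subtype_coe.comp (AddCircle.measurableEquivIco 1 0).measurable
  have hrept : ∀ t : ℝ, rep (t : UnitAddCircle) = Int.fract t := fun t => by
    simp [rep, AddCircle.coe_equivIco_mk_apply]
  let B : ℤ → Set UnitAddCircle := fun n => (fun y => c n + u * rep y) ⁻¹' A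
  have hBm : ∀ n, MeasurableSet (B n) := fun n =>
    ((hrep.const_mul u).const_add (c n)) hAm
  have hBt : ∀ (n : ℤ) (t : ℝ), (t : UnitAddCircle) ∈ B n ↔ c n + u * Int.fract t ∈ A := by
    intro n t
    simp only [B, Set.mem_preimage, hrept]
  have hB := rotation_extension_ergodic hBm fun n t => by
    rw [hBt, hBt]
    exact h.base_invariant hA n t
  rw [eventuallyConst_set']
  rcases hB with h0 | h0
  · left
    exact ae_eq_empty.2 (h.volume_eq_zero_of_base hA hBm (fun n t => (hBt n t).2) h0)
  · right
    refine ae_eq_univ.2 (h.volume_eq_zero_of_base (A := Aᶜ) (by rw [Set.preimage_compl, hA])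
      (fun n => (hBm n).compl) (fun n t ht => ?_) h0)
    exact fun hmem => ht ((hBt n t).1 hmem)

end IsTowerMap

/-! ### Cross sections and their towers -/

section Tower

variable {X : Type*} [AddAction ℝ X]

/-- `C` is a cross section whose points on the orbit of `x` are at distance at least `u x` from
each other, and meet every interval `(-2 u x, 0]` of the orbit. -/
structure IsCrossSection (C : Set X) (u : X → ℝ) : Prop where
  pos : ∀ x, 0 < u x
  invariant : ∀ (t : ℝ) x, u (t +ᵥ x) = u x
  separated : ∀ x (t : ℝ), 0 < t → x ∈ C → t +ᵥ x ∈ C → u x ≤ t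
  dense : ∀ x, ∃ t : ℝ, 0 ≤ t ∧ t < 2 * u x ∧ -t +ᵥ x ∈ C

/-- The distance from `x` to the next point of `C` strictly after it. -/
noncomputable def nextDist (C : Set X) (x : X) : ℝ := sInf {t : ℝ | 0 < t ∧ t +ᵥ x ∈ C}

/-- The distance from `x` to the last point of `C` strictly before it. -/
noncomputable def prevDist (C : Set X) (x : X) : ℝ := sInf {t : ℝ | 0 < t ∧ -t +ᵥ x ∈ C}

open Classical in
/-- The distance from `x` to the last point of `C` that is not after it. -/
noncomputable def cellOffset (C : Set X) (x : X) : ℝ := if x ∈ C then 0 else prevDist C x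

/-- The last point of `C` that is not after `x`. -/
noncomputable def cellStart (C : Set X) (x : X) : X := -cellOffset C x +ᵥ x

/-- The displacement of the tower over a cross section `C`. -/
noncomputable def towerDisplacement (C : Set X) (u : X → ℝ) (x : X) : ℝ :=
  if cellOffset C x + u x < nextDist C (cellStart C x) then u x
  else -cellOffset C x + u x * Int.fract (cellOffset C x / u x + rotationAngle) +
    if Int.fract (cellOffset C x / u x) < 1 / 2 then nextDist C (cellStart C x)
    else -prevDist C (cellStart C x)

/-- The orbit of `x` in coordinates: the trace of `C` on it. -/
def orbitTrace (C : Set X) (x : X) : Set ℝ := (fun t : ℝ => t +ᵥ x) ⁻¹' C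

theorem mem_orbitTrace {C : Set X} {x : X} {t : ℝ} : t ∈ orbitTrace C x ↔ t +ᵥ x ∈ C := Iff.rfl

/-- The line acts on itself, so the same definitions apply to the trace of `C` in ℝ. This and the
next lemmas reduce the study of one orbit to that of the line. -/
theorem nextDist_orbitTrace (C : Set X) (x : X) (t : ℝ) :
    nextDist (orbitTrace C x) t = nextDist C (t +ᵥ x) := by
  simp only [nextDist, mem_orbitTrace, vadd_eq_add, add_vadd]

theorem prevDist_orbitTrace (C : Set X) (x : X) (t : ℝ) :
    prevDist (orbitTrace C x) t = prevDist C (t +ᵥ x) := by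
  simp only [prevDist, mem_orbitTrace, vadd_eq_add, add_vadd]

theorem cellOffset_orbitTrace (C : Set X) (x : X) (t : ℝ) :
    cellOffset (orbitTrace C x) t = cellOffset C (t +ᵥ x) := by
  simp only [cellOffset, prevDist_orbitTrace]
  congr

theorem cellStart_orbitTrace (C : Set X) (x : X) (t : ℝ) :
    cellStart (orbitTrace C x) t +ᵥ x = cellStart C (t +ᵥ x) := by
  simp only [cellStart, cellOffset_orbitTrace, vadd_eq_add, add_vadd]

theorem towerDisplacement_orbitTrace {C : Set X} {u : X → ℝ} (h : IsCrossSection C u) (x : X)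
    (t : ℝ) :
    towerDisplacement (orbitTrace C x) (fun _ => u x) t = towerDisplacement C u (t +ᵥ x) := by
  simp only [towerDisplacement, cellOffset_orbitTrace, nextDist_orbitTrace, prevDist_orbitTrace,
    cellStart_orbitTrace, h.invariant]

theorem IsCrossSection.orbitTrace {C : Set X} {u : X → ℝ} (h : IsCrossSection C u) (x : X) :
    IsCrossSection (orbitTrace C x) (fun _ => u x) where
  pos _ := h.pos x
  invariant _ _ := rfl
  separated s t ht hs hts := by
    rw [mem_orbitTrace, vadd_eq_add, add_vadd] at hts
    rw [← h.invariant s x]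
    exact h.separated _ t ht hs hts
  dense s := by
    obtain ⟨t, h0, h1, h2⟩ := h.dense (s +ᵥ x)
    rw [h.invariant] at h1
    exact ⟨t, h0, h1, by rwa [mem_orbitTrace, vadd_eq_add, add_vadd]⟩

theorem nextDist_eq {C : Set X} {x : X} {v : ℝ} (hv : 0 < v) (hC : v +ᵥ x ∈ C)
    (hmin : ∀ w, 0 < w → w < v → w +ᵥ x ∉ C) : nextDist C x = v :=
  IsLeast.csInf_eq ⟨⟨hv, hC⟩, fun w hw => by
    by_contra! hlt
    exact hmin w hw.1 hlt hw.2⟩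

theorem prevDist_eq {C : Set X} {x : X} {v : ℝ} (hv : 0 < v) (hC : -v +ᵥ x ∈ C)
    (hmin : ∀ w, 0 < w → w < v → -w +ᵥ x ∉ C) : prevDist C x = v :=
  IsLeast.csInf_eq ⟨⟨hv, hC⟩, fun w hw => by
    by_contra! hlt
    exact hmin w hw.1 hlt hw.2⟩

end Tower

/-- A nonempty set of reals that is bounded below and has separated points has a least element. -/
theorem exists_isLeast_of_separated {A : Set ℝ} {u : ℝ} (hu : 0 < u)
    (hsep : ∀ a ∈ A, ∀ b ∈ A, a < b → a + u ≤ b) (hne : A.Nonempty) (hbdd : BddBelow A) :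
    ∃ a, IsLeast A a := by
  obtain ⟨a, ha, hlt⟩ := Real.lt_sInf_add_pos hne hu
  refine ⟨a, ha, fun b hb => ?_⟩
  by_contra! hba
  have h1 := hsep b hb a ha hba
  have h2 := csInf_le hbdd hb
  linarith

/-! ### The successor map of a cross section and the cells on the line. -/

namespace IsCrossSection

section Exists

variable {X : Type*} [AddAction ℝ X] {C : Set X} {u : X → ℝ} (h : IsCrossSection C u)

include h

theorem eq_or_le {x : X} {s t : ℝ} (hs : s +ᵥ x ∈ C) (ht : t +ᵥ x ∈ C) (hst : s < t) :
    s + u x ≤ t := by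
  have := h.separated (s +ᵥ x) (t - s) (by linarith) hs (by rwa [← add_vadd, sub_add_cancel])
  rw [h.invariant] at this
  linarith

theorem isLeast_next (x : X) : IsLeast {t : ℝ | 0 < t ∧ t +ᵥ x ∈ C} (nextDist C x) := by
  have hne : {t : ℝ | 0 < t ∧ t +ᵥ x ∈ C}.Nonempty := by
    -- Looking back from time `2 * u x` finds a visit in `(0, 2 * u x]`.
    obtain ⟨t, h0, h1, h2⟩ := h.dense ((2 * u x) +ᵥ x)
    rw [h.invariant] at h1
    exact ⟨-t + 2 * u x, by linarith, by rwa [add_vadd]⟩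
  obtain ⟨a, ha⟩ := exists_isLeast_of_separated (h.pos x)
    (fun a ha b hb hab => h.eq_or_le ha.2 hb.2 hab) hne ⟨0, fun t ht => ht.1.le⟩
  rwa [nextDist, ha.csInf_eq]

theorem isLeast_prev (x : X) : IsLeast {t : ℝ | 0 < t ∧ -t +ᵥ x ∈ C} (prevDist C x) := by
  have hne : {t : ℝ | 0 < t ∧ -t +ᵥ x ∈ C}.Nonempty := by
    have hu := h.pos x
    obtain ⟨t, h0, h1, h2⟩ := h.dense ((-u x) +ᵥ x)
    rw [h.invariant] at h1
    exact ⟨t + u x, by linarith, by rwa [neg_add, add_vadd]⟩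
  obtain ⟨a, ha⟩ := exists_isLeast_of_separated (h.pos x)
    (fun a ha b hb hab => by have := h.eq_or_le hb.2 ha.2 (neg_lt_neg hab); linarith) hne
    ⟨0, fun t ht => ht.1.le⟩
  rwa [prevDist, ha.csInf_eq]

theorem nextDist_le_of_mem {x : X} {t : ℝ} (ht : 0 < t) (htx : t +ᵥ x ∈ C) : nextDist C x ≤ t :=
  (h.isLeast_next x).2 ⟨ht, htx⟩

theorem prevDist_le_of_mem {x : X} {t : ℝ} (ht : 0 < t) (htx : -t +ᵥ x ∈ C) : prevDist C x ≤ t :=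
  (h.isLeast_prev x).2 ⟨ht, htx⟩

theorem nextDist_le (x : X) : nextDist C x ≤ 2 * u x := by
  obtain ⟨t, h0, h1, h2⟩ := h.dense ((2 * u x) +ᵥ x)
  rw [h.invariant] at h1
  have := h.nextDist_le_of_mem (t := -t + 2 * u x) (by linarith) (by rwa [add_vadd])
  linarith

theorem le_nextDist {x : X} (hx : x ∈ C) : u x ≤ nextDist C x :=
  h.separated x _ (h.isLeast_next x).1.1 hx (h.isLeast_next x).1.2

theorem prevDist_next {x : X} (hx : x ∈ C) : prevDist C (nextDist C x +ᵥ x) = nextDist C x := by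
  have hn := h.isLeast_next x
  refine prevDist_eq hn.1.1 (by rwa [neg_vadd_vadd]) fun w h0 h1 hw => ?_
  rw [← add_vadd] at hw
  have := h.nextDist_le_of_mem (t := -w + nextDist C x) (by linarith) hw
  linarith

theorem nextDist_prev {x : X} (hx : x ∈ C) : nextDist C (-prevDist C x +ᵥ x) = prevDist C x := by
  have hn := h.isLeast_prev x
  refine nextDist_eq hn.1.1 (by rwa [vadd_neg_vadd]) fun w h0 h1 hw => ?_
  rw [← add_vadd] at hw
  have := h.prevDist_le_of_mem (t := prevDist C x - w) (by linarith)
    (by rwa [neg_sub, sub_eq_add_neg])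
  linarith

/-- The successor map on a cross section. -/
noncomputable def succ : C ≃ C where
  toFun x := ⟨nextDist C (x : X) +ᵥ (x : X), (h.isLeast_next _).1.2⟩
  invFun x := ⟨-prevDist C (x : X) +ᵥ (x : X), (h.isLeast_prev _).1.2⟩
  left_inv x := Subtype.ext (by
    simp only
    rw [h.prevDist_next x.2, neg_vadd_vadd])
  right_inv x := Subtype.ext (by
    simp only
    rw [h.nextDist_prev x.2, vadd_neg_vadd])

end Exists

section Line

variable {P : Set ℝ} {u : ℝ} (h : IsCrossSection P (fun _ => u))

include h

/-- The powers of the successor permutation, applied to one point. That they exhaust `P` need not be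
shown, because gaps of length at least `u` already make the cells cover the line. -/
theorem exists_enumeration : ∃ c : ℤ → ℝ, (∀ n, c n ∈ P) ∧
    (∀ n, nextDist P (c n) = c (n + 1) - c n) ∧ ∀ n, prevDist P (c n) = c n - c (n - 1) := by
  obtain ⟨t, -, -, ht⟩ := h.dense 0
  let σ : Equiv.Perm P := h.succ
  let c : ℤ → P := fun n => (σ ^ n) ⟨_, ht⟩
  have hc : ∀ n, nextDist P (c n : ℝ) = c (n + 1) - c n := by
    intro n
    have : c (n + 1) = σ (c n) := by
      simp only [c]
      rw [add_comm, zpow_one_add, Equiv.Perm.mul_apply]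
    rw [this]
    exact (add_sub_cancel_right _ _).symm
  refine ⟨fun n => c n, fun n => (c n).2, hc, fun n => ?_⟩
  have h1 := hc (n - 1)
  rw [sub_add_cancel] at h1
  have h2 := h.prevDist_next (c (n - 1)).2
  rw [vadd_eq_add, h1, sub_add_cancel] at h2
  exact h2

theorem isTowerMap : ∃ c : ℤ → ℝ,
    IsTowerMap c u (fun t => towerDisplacement P (fun _ => u) t + t) := by
  obtain ⟨c, hcP, hnext, hprev⟩ := h.exists_enumeration
  have hoff : ∀ n s, 0 ≤ s → s < c (n + 1) - c n → cellOffset P (c n + s) = s := by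
    intro n s hs hs'
    have hnot : ∀ w, 0 < w → w ≤ s → c n + w ∉ P := by
      intro w h0 h1 hw
      have := h.nextDist_le_of_mem (x := c n) h0 (by rwa [vadd_eq_add, add_comm])
      rw [hnext] at this
      linarith
    rcases hs.eq_or_lt with rfl | hs0
    · rw [cellOffset, if_pos (by rw [add_zero]; exact hcP n)]
    · rw [cellOffset, if_neg (hnot s hs0 le_rfl)]
      refine prevDist_eq hs0 ?_ fun w h0 h1 hw => hnot (s - w) (by linarith) (by linarith) ?_
      · rw [vadd_eq_add, neg_add_cancel_comm_assoc]
        exact hcP n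
      · rw [vadd_eq_add] at hw
        rwa [show c n + (s - w) = -w + (c n + s) by ring]
  have hstart : ∀ n s, 0 ≤ s → s < c (n + 1) - c n → cellStart P (c n + s) = c n := by
    intro n s hs hs'
    rw [cellStart, hoff n s hs hs', vadd_eq_add]
    ring
  have hu : 0 < u := h.pos 0
  refine ⟨c, hu, fun n => ?_, fun n => ?_, fun n s hs h1 => ?_, fun n s hs hs' h1 => ?_⟩
  · rw [← hnext]
    exact h.le_nextDist (hcP n)
  · rw [← hnext]
    exact h.nextDist_le _
  · have hs' : s < c (n + 1) - c n := by linarith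
    simp only [towerDisplacement]
    rw [hoff n s hs hs', hstart n s hs hs', hnext, if_pos h1]
    ring
  · simp only [towerDisplacement]
    rw [hoff n s hs hs', hstart n s hs hs', hnext, hprev, if_neg (not_lt.2 h1), rotationStep]
    split_ifs
    · ring
    · rw [← sub_eq_add_neg n 1]
      ring

end Line

end IsCrossSection

/-! ### Measurability -/

section Measurability

variable {X : Type*} [MeasurableSpace X] [StandardBorelSpace X] [AddAction ℝ X]
  [MeasurableVAdd₂ ℝ X] {C : Set X} {u : X → ℝ}

/-- The projection of the visits to a separated Borel set is Borel. -/
theorem measurableSet_exists_visit (hC : MeasurableSet C) (hu : Measurable u)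
    (hpos : ∀ x, 0 < u x) (hinv : ∀ (t : ℝ) x, u (t +ᵥ x) = u x)
    (hsep : ∀ x (t : ℝ), 0 < t → x ∈ C → t +ᵥ x ∈ C → u x ≤ t)
    {W : Set (X × ℝ)} (hW : MeasurableSet W) :
    MeasurableSet {x : X | ∃ t : ℝ, (x, t) ∈ W ∧ t +ᵥ x ∈ C} := by
  -- Each time window `⌊t / u x⌋ = k` contains at most one visit, so the projection is injective on
  -- `V k` and the Lusin–Souslin theorem applies.
  let V : ℤ → Set (X × ℝ) := fun k => W ∩ {p | p.2 +ᵥ p.1 ∈ C} ∩ {p | ⌊p.2 / u p.1⌋ = k}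
  have hV : ∀ k, MeasurableSet (V k) := by
    intro k
    refine (hW.inter ?_).inter ?_
    · exact (measurable_snd.vadd measurable_fst) hC
    · exact (Int.measurable_floor.comp
        (measurable_snd.div (hu.comp measurable_fst))) (measurableSet_singleton k)
  have hinj : ∀ k, Set.InjOn Prod.fst (V k) := by
    rintro k ⟨x, s⟩ ⟨⟨-, hs⟩, hsk⟩ ⟨y, t⟩ ⟨⟨-, ht⟩, htk⟩ (rfl : x = y)
    have key : ∀ s t : ℝ, s +ᵥ x ∈ C → t +ᵥ x ∈ C → ⌊s / u x⌋ = k → ⌊t / u x⌋ = k → ¬ s < t := by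
      intro s t hs ht hsk htk hst
      have h1 := hsep (s +ᵥ x) (t - s) (by linarith) hs (by rwa [← add_vadd, sub_add_cancel])
      rw [hinv] at h1
      rw [Int.floor_eq_iff, le_div_iff₀ (hpos x), div_lt_iff₀ (hpos x)] at hsk htk
      linarith
    have := le_antisymm (not_lt.1 (key t s ht hs htk hsk)) (not_lt.1 (key s t hs ht hsk htk))
    rw [this]
  have : {x : X | ∃ t : ℝ, (x, t) ∈ W ∧ t +ᵥ x ∈ C} = ⋃ k, Prod.fst '' V k := by
    ext x
    simp only [Set.mem_ofPred_eq, Set.mem_iUnion, Set.mem_image, Prod.exists, exists_and_right,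
      exists_eq_right]
    constructor
    · rintro ⟨t, hW, hC⟩
      exact ⟨_, t, ⟨hW, hC⟩, rfl⟩
    · rintro ⟨k, t, ⟨hW, hC⟩, -⟩
      exact ⟨t, hW, hC⟩
  rw [this]
  exact MeasurableSet.iUnion fun k =>
    (hV k).image_of_measurable_injOn measurable_fst (hinj k)

namespace IsCrossSection

variable (h : IsCrossSection C u) (hC : MeasurableSet C) (hu : Measurable u)

include h hC hu

theorem measurable_nextDist : Measurable (nextDist C) := by
  refine measurable_of_Iio fun r => ?_
  have : nextDist C ⁻¹' Set.Iio r = {x : X | ∃ t : ℝ, (x, t) ∈ {p : X × ℝ | 0 < p.2 ∧ p.2 < r} ∧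
      t +ᵥ x ∈ C} := by
    ext x
    have hx := h.isLeast_next x
    constructor
    · intro hr
      exact ⟨_, ⟨hx.1.1, hr⟩, hx.1.2⟩
    · rintro ⟨t, ⟨h0, h1⟩, h2⟩
      exact (h.nextDist_le_of_mem h0 h2).trans_lt h1
  rw [this]
  exact measurableSet_exists_visit hC hu h.pos h.invariant h.separated
    ((measurableSet_lt measurable_const measurable_snd).inter
      (measurableSet_lt measurable_snd measurable_const))

theorem measurable_prevDist : Measurable (prevDist C) := by
  refine measurable_of_Iio fun r => ?_
  have : prevDist C ⁻¹' Set.Iio r = {x : X | ∃ t : ℝ, (x, t) ∈ {p : X × ℝ | p.2 < 0 ∧ -r < p.2} ∧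
      t +ᵥ x ∈ C} := by
    ext x
    have hx := h.isLeast_prev x
    constructor
    · intro hr
      exact ⟨_, ⟨neg_lt_zero.2 hx.1.1, neg_lt_neg hr⟩, hx.1.2⟩
    · rintro ⟨t, ⟨h0, h1⟩, h2⟩
      exact (h.prevDist_le_of_mem (neg_pos.2 h0) (by rwa [neg_neg])).trans_lt (neg_lt.1 h1)
  rw [this]
  exact measurableSet_exists_visit hC hu h.pos h.invariant h.separated
    ((measurableSet_lt measurable_snd measurable_const).inter
      (measurableSet_lt measurable_const measurable_snd))

theorem measurable_towerDisplacement : Measurable (towerDisplacement C u) := by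
  have hn := h.measurable_nextDist hC hu
  have hp := h.measurable_prevDist hC hu
  have ho : Measurable (cellOffset C) := Measurable.ite hC measurable_const hp
  have hs : Measurable (cellStart C) := ho.neg.vadd measurable_id
  refine Measurable.ite (measurableSet_lt (ho.add hu) (hn.comp hs)) hu ?_
  refine (ho.neg.add (hu.mul ((ho.div hu).add_const _).fract)).add ?_
  exact Measurable.ite (measurableSet_lt (ho.div hu).fract measurable_const) (hn.comp hs)
    (hp.comp hs).neg

end IsCrossSection

end Measurability

/-! ### Existence of Borel cross sections -/

/-! ### Filling the gaps of a separated set. -/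

section Filling

variable {X : Type*} [AddAction ℝ X]

/-- The points obtained from `C` by placing points at distance `u` from each other in the gaps. -/
def filling (C : Set X) (u : X → ℝ) : Set X :=
  {x | ∃ j : ℕ, -(j * u x) +ᵥ x ∈ C ∧ ¬ ∃ t : ℝ, (-(j * u x) < t ∧ t < u x) ∧ t +ᵥ x ∈ C} ∪
  {x | ∃ j : ℕ, (j * u x) +ᵥ x ∈ C ∧ ¬ ∃ t : ℝ, t < j * u x ∧ t +ᵥ x ∈ C}

variable {C : Set X} {u : X → ℝ}

theorem mem_filling_vadd (hinv : ∀ (t : ℝ) x, u (t +ᵥ x) = u x) (x : X) (s : ℝ) :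
    s +ᵥ x ∈ filling C u ↔
      (∃ j : ℕ, (s - j * u x) +ᵥ x ∈ C ∧ ∀ w : ℝ, s - j * u x < w → w < s + u x → w +ᵥ x ∉ C) ∨
      (∃ j : ℕ, (s + j * u x) +ᵥ x ∈ C ∧ ∀ w : ℝ, w < s + j * u x → w +ᵥ x ∉ C) := by
  simp only [filling, Set.mem_union, Set.mem_ofPred_eq, hinv, ← add_vadd]
  refine or_congr (exists_congr fun j => and_congr ?_ ?_) (exists_congr fun j => and_congr ?_ ?_)
  · rw [neg_add_eq_sub]
  · constructor
    · intro h w h1 h2 hw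
      exact h ⟨w - s, ⟨by linarith, by linarith⟩, by rwa [sub_add_cancel]⟩
    · rintro h ⟨t, ⟨h1, h2⟩, ht⟩
      exact h (t + s) (by linarith) (by linarith) ht
  · rw [add_comm]
  · constructor
    · intro h w h1 hw
      exact h ⟨w - s, by linarith, by rwa [sub_add_cancel]⟩
    · rintro h ⟨t, h1, ht⟩
      exact h (t + s) (by linarith) ht

/-- Points are placed at multiples of `u` after each point of `C`, except those less than `u` before
the next point of `C`; leaving these out keeps every gap at least `u` and still below `2 * u`. If
`C` has a first point on the orbit, multiples of `u` before it are added as well. -/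
theorem isCrossSection_filling (hpos : ∀ x, 0 < u x) (hinv : ∀ (t : ℝ) x, u (t +ᵥ x) = u x)
    (hsep : ∀ x (t : ℝ), 0 < t → x ∈ C → t +ᵥ x ∈ C → u x ≤ t) (hne : ∀ x, ∃ t : ℝ, t +ᵥ x ∈ C) :
    IsCrossSection (filling C u) u where
  pos := hpos
  invariant := hinv
  separated x t ht hx hxt := by
    have hu := hpos x
    rw [← zero_vadd ℝ x, mem_filling_vadd hinv] at hx
    rw [mem_filling_vadd hinv] at hxt
    have hmul : ∀ i j : ℕ, 0 < ((i : ℝ) - j) * u x → u x ≤ (i - j) * u x := by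
      intro i j h
      have h1 : (j : ℝ) < i := by
        by_contra! hle
        nlinarith
      have h2 : (j : ℝ) + 1 ≤ i := by exact_mod_cast h1
      nlinarith
    have hnn : ∀ i : ℕ, 0 ≤ (i : ℝ) * u x := fun i => by positivity
    by_contra! hlt
    rcases hx with ⟨j, h1, h2⟩ | ⟨j, h1, h2⟩ <;> rcases hxt with ⟨i, h3, h4⟩ | ⟨i, h3, h4⟩
    · have e1 : t - i * u x ≤ 0 - j * u x := by
        by_contra! h
        exact h2 _ h (by linarith [hnn i]) h3
      have e2 : 0 - j * u x ≤ t - i * u x := by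
        by_contra! h
        exact h4 _ h (by linarith [hnn j]) h1
      have := hmul i j (by linarith)
      linarith
    · exact h4 _ (by linarith [hnn i, hnn j]) h1
    · have e1 : 0 + j * u x ≤ t - i * u x := by
        by_contra! h
        exact h2 _ h h3
      have hij : i + j = 0 := by
        by_contra hne
        have : (1 : ℝ) ≤ i + j := by exact_mod_cast Nat.one_le_iff_ne_zero.2 hne
        nlinarith
      obtain ⟨rfl, rfl⟩ : i = 0 ∧ j = 0 := by omega
      simp only [Nat.cast_zero, zero_mul, add_zero, sub_zero, zero_vadd] at h1 h3
      exact absurd (hsep x t ht h1 h3) (not_le.2 hlt)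
    · have e1 : 0 + j * u x ≤ t + i * u x := by
        by_contra! h
        exact h2 _ h h3
      have e2 : t + i * u x ≤ 0 + j * u x := by
        by_contra! h
        exact h4 _ h h1
      have := hmul j i (by linarith)
      linarith
  dense x := by
    have hu := hpos x
    have hsep' : ∀ a b : ℝ, a +ᵥ x ∈ C → b +ᵥ x ∈ C → a < b → a + u x ≤ b := by
      intro a b ha hb hab
      have := hsep (a +ᵥ x) (b - a) (by linarith) ha (by rwa [← add_vadd, sub_add_cancel])
      rw [hinv] at this
      linarith
    by_cases hpast : ∃ s : ℝ, s ≤ 0 ∧ s +ᵥ x ∈ C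
    · obtain ⟨s₀, hs₀, hs₀C⟩ := hpast
      obtain ⟨a, ⟨ha0, haC⟩, hleast⟩ := exists_isLeast_of_separated
        (A := {a : ℝ | 0 ≤ a ∧ -a +ᵥ x ∈ C}) hu
        (fun a ha b hb hab => by have := hsep' _ _ hb.2 ha.2 (neg_lt_neg hab); linarith)
        ⟨-s₀, by linarith, by rwa [neg_neg]⟩ ⟨0, fun a ha => ha.1⟩
      have hnot : ∀ w : ℝ, -a < w → w ≤ 0 → w +ᵥ x ∉ C := by
        intro w h1 h2 hw
        have : a ≤ -w := hleast ⟨by linarith, by rwa [neg_neg]⟩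
        linarith
      have hK1 : (⌊a / u x⌋₊ : ℝ) * u x ≤ a := by
        rw [← le_div_iff₀ hu]
        exact Nat.floor_le (by positivity)
      have hK2 : a < (⌊a / u x⌋₊ + 1 : ℝ) * u x := by
        rw [← div_lt_iff₀ hu]
        exact Nat.lt_floor_add_one _
      set K := ⌊a / u x⌋₊
      -- If the last candidate not after `x` is too close to the next point of `C`, it was left out
      -- and the candidate one step earlier serves.
      by_cases hnext : ∃ w : ℝ, 0 < w ∧ w < -a + K * u x + u x ∧ w +ᵥ x ∈ C
      · obtain ⟨w, hw0, hw1, hwC⟩ := hnext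
        have hKpos : K ≠ 0 := by
          intro hK
          have := hsep' _ _ haC hwC (by linarith)
          rw [hK, Nat.cast_zero, zero_mul] at hw1
          linarith
        obtain ⟨k, hk⟩ := Nat.exists_eq_succ_of_ne_zero hKpos
        have hKk : (K : ℝ) = k + 1 := by rw [hk]; push_cast; ring
        rw [hKk] at hK1 hK2
        refine ⟨a - k * u x, by linarith, by linarith, ?_⟩
        rw [mem_filling_vadd hinv]
        refine Or.inl ⟨k, ?_, fun w h1 h2 => hnot w (by linarith) (by linarith)⟩
        rwa [show -(a - k * u x) - k * u x = -a by ring]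
      · push Not at hnext
        refine ⟨a - K * u x, by linarith, by linarith, ?_⟩
        rw [mem_filling_vadd hinv]
        refine Or.inl ⟨K, ?_, fun w h1 h2 => ?_⟩
        · rwa [show -(a - K * u x) - K * u x = -a by ring]
        · rcases le_or_gt w 0 with hw | hw
          · exact hnot w (by linarith) hw
          · exact hnext w hw (by linarith)
    · push Not at hpast
      obtain ⟨s₀, hs₀C⟩ := hne x
      obtain ⟨a, haC, hleast⟩ := exists_isLeast_of_separated (A := {a : ℝ | a +ᵥ x ∈ C}) hu
        (fun a ha b hb hab => hsep' _ _ ha hb hab) ⟨s₀, hs₀C⟩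
        ⟨0, fun a ha => by by_contra! hlt; exact hpast a hlt.le ha⟩
      have ha0 : 0 < a := by
        by_contra! hle
        exact hpast a hle haC
      have hK1 : a ≤ (⌈a / u x⌉₊ : ℝ) * u x := by
        rw [← div_le_iff₀ hu]
        exact Nat.le_ceil _
      have hK2 : (⌈a / u x⌉₊ : ℝ) * u x < a + u x := by
        have : (⌈a / u x⌉₊ : ℝ) < a / u x + 1 := Nat.ceil_lt_add_one (by positivity)
        calc _ < (a / u x + 1) * u x := by gcongr
          _ = a + u x := by field_simp
      set K := ⌈a / u x⌉₊
      refine ⟨K * u x - a, by linarith, by linarith, ?_⟩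
      rw [mem_filling_vadd hinv]
      refine Or.inr ⟨K, ?_, fun w h1 h2 => ?_⟩
      · rwa [show -(K * u x - a) + K * u x = a by ring]
      · have : a ≤ w := hleast h2
        linarith

theorem measurableSet_filling [MeasurableSpace X] [StandardBorelSpace X] [MeasurableVAdd₂ ℝ X]
    (hC : MeasurableSet C) (hu : Measurable u)
    (hpos : ∀ x, 0 < u x) (hinv : ∀ (t : ℝ) x, u (t +ᵥ x) = u x)
    (hsep : ∀ x (t : ℝ), 0 < t → x ∈ C → t +ᵥ x ∈ C → u x ≤ t) :
    MeasurableSet (filling C u) := by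
  have hfst : Measurable fun p : X × ℝ => u p.1 := hu.comp measurable_fst
  have h1 : filling C u =
      (⋃ j : ℕ, ((fun x => -(j * u x) +ᵥ x) ⁻¹' C) ∩ {x | ∃ t : ℝ,
        (x, t) ∈ {p : X × ℝ | -(j * u p.1) < p.2 ∧ p.2 < u p.1} ∧ t +ᵥ x ∈ C}ᶜ) ∪
      ⋃ j : ℕ, ((fun x => (j * u x) +ᵥ x) ⁻¹' C) ∩ {x | ∃ t : ℝ,
        (x, t) ∈ {p : X × ℝ | p.2 < j * u p.1} ∧ t +ᵥ x ∈ C}ᶜ := by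
    ext x
    simp [filling]
  rw [h1]
  refine (MeasurableSet.iUnion fun j => ?_).union (MeasurableSet.iUnion fun j => ?_)
  · refine (((hu.const_mul _).neg.vadd measurable_id) hC).inter
      (measurableSet_exists_visit hC hu hpos hinv hsep ?_).compl
    exact (measurableSet_lt (hfst.const_mul _).neg measurable_snd).inter
      (measurableSet_lt measurable_snd hfst)
  · exact (((hu.const_mul _).vadd measurable_id) hC).inter
      (measurableSet_exists_visit hC hu hpos hinv hsep
        (measurableSet_lt measurable_snd (hfst.const_mul _))).compl

end Filling

/-! ### Upcrossings of a function that is continuous along the orbits. -/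

section Upcrossings

variable {X : Type*} [AddAction ℝ X]

/-- The points from which `H` goes from negative values to values above `1`, without becoming
negative meanwhile. -/
def upcrossingSet (H : X → ℝ) : Set X :=
  {x | (∀ ε : ℚ, 0 < ε → ∃ r : ℚ, (0 < r ∧ r < ε) ∧ H (-(r : ℝ) +ᵥ x) < 0) ∧
    ∃ q : ℚ, (0 < q ∧ 1 < H ((q : ℝ) +ᵥ x)) ∧ ∀ r : ℚ, 0 < r ∧ r < q → 0 ≤ H ((r : ℝ) +ᵥ x)}

/-- The definition quantifies over rational times only; continuity along orbits will recover the
meaning for real times. -/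
theorem measurableSet_upcrossingSet [MeasurableSpace X] [MeasurableVAdd₂ ℝ X] {H : X → ℝ}
    (hH : Measurable H) : MeasurableSet (upcrossingSet H) := by
  have hm : ∀ t : ℝ, Measurable fun x => H (t +ᵥ x) := fun t => hH.comp (measurable_const_vadd t)
  have hlt : ∀ t a : ℝ, Measurable fun x => H (t +ᵥ x) < a := fun t a =>
    measurableSet_setOfPred.1 (measurableSet_lt (hm t) measurable_const)
  have hgt : ∀ t a : ℝ, Measurable fun x => a < H (t +ᵥ x) := fun t a =>
    measurableSet_setOfPred.1 (measurableSet_lt measurable_const (hm t))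
  have hge : ∀ t a : ℝ, Measurable fun x => a ≤ H (t +ᵥ x) := fun t a =>
    measurableSet_setOfPred.1 (measurableSet_le measurable_const (hm t))
  refine measurableSet_setOfPred.2 (Measurable.and ?_ ?_)
  · exact Measurable.forall fun ε => Measurable.imp measurable_const
      (Measurable.exists fun r => measurable_const.and (hlt _ _))
  · exact Measurable.exists fun q => (measurable_const.and (hgt _ _)).and
      (Measurable.forall fun r => Measurable.imp measurable_const (hge _ _))

theorem exists_rat_add_mem {U : Set ℝ} (hU : IsOpen U) (hne : U.Nonempty) (c : ℝ) :
    ∃ q : ℚ, c + q ∈ U := by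
  obtain ⟨t, ht⟩ := hne
  obtain ⟨q, hq⟩ := Rat.denseRange_cast.exists_mem_open (hU.preimage (continuous_const_add c))
    ⟨t - c, by simpa using ht⟩
  exact ⟨q, hq⟩

variable {H : X → ℝ} {x : X}

theorem le_zero_of_mem_upcrossingSet (hcont : Continuous fun t : ℝ => H (t +ᵥ x))
    (hx : x ∈ upcrossingSet H) : H x ≤ 0 := by
  by_contra! hpos
  have h0 : ∀ᶠ t in 𝓝 (0 : ℝ), 0 < H (t +ᵥ x) :=
    hcont.continuousAt.eventually (lt_mem_nhds (by simpa using hpos))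
  obtain ⟨ε, hε, hball⟩ := Metric.eventually_nhds_iff.1 h0
  obtain ⟨e, he0, he⟩ := exists_rat_btwn hε
  obtain ⟨r, ⟨hr0, hre⟩, hr⟩ := hx.1 e (by exact_mod_cast he0)
  have hr0' : (0 : ℝ) < r := by exact_mod_cast hr0
  have hre' : (r : ℝ) < e := by exact_mod_cast hre
  have := hball (y := -(r : ℝ)) (by
    rw [Real.dist_eq, sub_zero, abs_neg, abs_of_pos hr0']; linarith)
  linarith

/-- After an upcrossing `H` must climb from at most `0` to above `1` before it may be negative
again, and the Lipschitz bound makes this take time at least `u`. The next upcrossing has negative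
values just before it. -/
theorem upcrossingSet_separated {u : ℝ} (hu : 0 < u) (hcont : Continuous fun t : ℝ => H (t +ᵥ x))
    (hlip : ∀ t : ℝ, u * |H (t +ᵥ x) - H x| ≤ |t|) {t : ℝ} (ht : 0 < t) (hx : x ∈ upcrossingSet H)
    (hxt : t +ᵥ x ∈ upcrossingSet H) : u ≤ t := by
  obtain ⟨q, ⟨hq0, hq1⟩, hq⟩ := hx.2
  have hq0' : (0 : ℝ) < q := by exact_mod_cast hq0
  have hqt : (q : ℝ) ≤ t := by
    by_contra! hlt
    obtain ⟨e, he0, he⟩ := exists_rat_btwn ht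
    obtain ⟨r, ⟨hr0, hre⟩, hr⟩ := hxt.1 e (by exact_mod_cast he0)
    have hr0' : (0 : ℝ) < r := by exact_mod_cast hr0
    have hre' : (r : ℝ) < e := by exact_mod_cast hre
    have hopen : IsOpen ({s : ℝ | H (s +ᵥ x) < 0} ∩ Set.Ioo 0 (q : ℝ)) :=
      (isOpen_lt hcont continuous_const).inter isOpen_Ioo
    obtain ⟨p, hp1, hp2, hp3⟩ := exists_rat_add_mem hopen
      ⟨-r + t, by rwa [← add_vadd] at hr, by linarith, by linarith⟩ 0
    rw [zero_add] at hp2 hp3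
    have hp1 : H (((0 : ℝ) + p) +ᵥ x) < 0 := hp1
    rw [zero_add] at hp1
    have := hq p ⟨by exact_mod_cast hp2, by exact_mod_cast hp3⟩
    linarith
  have h0 := le_zero_of_mem_upcrossingSet hcont hx
  have h1 := hlip q
  rw [abs_of_pos hq0', abs_of_pos (by linarith)] at h1
  nlinarith

theorem exists_mem_upcrossingSet (hcont : Continuous fun t : ℝ => H (t +ᵥ x)) {a b : ℝ} (hab : a < b)
    (ha : H (a +ᵥ x) < 0) (hb : 1 < H (b +ᵥ x)) : ∃ c : ℝ, c +ᵥ x ∈ upcrossingSet H := by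
  set f : ℝ → ℝ := fun t => H (t +ᵥ x) with hf
  let A : Set ℝ := {t | t ≤ b ∧ f t < 0}
  have hA : a ∈ A := ⟨hab.le, ha⟩
  have hbdd : BddAbove A := ⟨b, fun t ht => ht.1⟩
  -- The last time before `b` at which negative values accumulate is the upcrossing.
  set c := sSup A with hc
  have hcb : c ≤ b := csSup_le ⟨a, hA⟩ fun t ht => ht.1
  have hright : ∀ t, c < t → t ≤ b → 0 ≤ f t := by
    intro t h1 h2
    by_contra! h3
    exact absurd (le_csSup hbdd (show t ∈ A from ⟨h2, h3⟩)) (not_le.2 h1)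
  have hfc : f c ≤ 0 := by
    by_contra! hpos
    obtain ⟨ε, hε, hball⟩ := Metric.eventually_nhds_iff.1
      (hcont.continuousAt.eventually (lt_mem_nhds hpos))
    obtain ⟨t, ht, htc⟩ := exists_lt_of_lt_csSup ⟨a, hA⟩ (show c - ε < sSup A by linarith)
    have htc' := le_csSup hbdd ht
    have := hball (y := t) (by rw [Real.dist_eq, abs_sub_lt_iff]; constructor <;> linarith)
    linarith [ht.2]
  have hcb' : c < b := lt_of_le_of_ne hcb fun h => by
    rw [h] at hfc
    linarith
  have hleft : ∀ ε > 0, ∃ t, c - ε < t ∧ t < c ∧ f t < 0 := by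
    intro ε hε
    obtain ⟨t, ht, htc⟩ := exists_lt_of_lt_csSup ⟨a, hA⟩ (show c - ε < sSup A by linarith)
    rcases (le_csSup hbdd ht).lt_or_eq with h | h
    · exact ⟨t, htc, h, ht.2⟩
    · exfalso
      obtain ⟨δ, hδ, hball⟩ := Metric.eventually_nhds_iff.1
        (hcont.continuousAt.eventually (gt_mem_nhds ht.2))
      have hmin : 0 < min δ (b - t) := lt_min hδ (by linarith)
      have h1 := min_le_left δ (b - t)
      have h2 := min_le_right δ (b - t)
      have := hball (y := t + min δ (b - t) / 2) (by
        rw [Real.dist_eq, add_sub_cancel_left, abs_of_pos (by linarith)]; linarith)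
      have := hright (t + min δ (b - t) / 2) (by linarith) (by linarith)
      linarith
  refine ⟨c, fun ε hε => ?_, ?_⟩
  · have hε' : (0 : ℝ) < ε := by exact_mod_cast hε
    obtain ⟨t, h1, h2, h3⟩ := hleft ε hε'
    obtain ⟨q, hq1, hq2, hq3⟩ := exists_rat_add_mem
      (((isOpen_lt hcont continuous_const).inter isOpen_Ioo :
        IsOpen ({s : ℝ | f s < 0} ∩ Set.Ioo (c - ε) c))) ⟨t, h3, h1, h2⟩ c
    have e1 : (0 : ℝ) < -q := by linarith
    have e2 : (-q : ℝ) < ε := by linarith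
    refine ⟨-q, ⟨by exact_mod_cast e1, by exact_mod_cast e2⟩, ?_⟩
    have hq1 : H ((c + q) +ᵥ x) < 0 := hq1
    rw [← add_vadd]
    push_cast
    rwa [neg_neg, add_comm]
  · have hbn : ∃ t, c < t ∧ t < b ∧ 1 < f t := by
      obtain ⟨δ, hδ, hball⟩ := Metric.eventually_nhds_iff.1
        (hcont.continuousAt.eventually (lt_mem_nhds hb))
      have hmin : 0 < min δ (b - c) := lt_min hδ (by linarith)
      have h1 := min_le_left δ (b - c)
      have h2 := min_le_right δ (b - c)
      refine ⟨b - min δ (b - c) / 2, by linarith, by linarith, hball ?_⟩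
      rw [Real.dist_eq, sub_sub_cancel_left, abs_neg, abs_of_pos (by linarith)]
      linarith
    obtain ⟨t, h1, h2, h3⟩ := hbn
    obtain ⟨q, hq1, hq2, hq3⟩ := exists_rat_add_mem
      (((isOpen_lt continuous_const hcont).inter isOpen_Ioo :
        IsOpen ({s : ℝ | 1 < f s} ∩ Set.Ioo c b))) ⟨t, h3, h1, h2⟩ c
    have e1 : (0 : ℝ) < q := by linarith
    refine ⟨q, ⟨by exact_mod_cast e1, ?_⟩, fun r hr => ?_⟩
    · have hq1 : 1 < H ((c + q) +ᵥ x) := hq1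
      rwa [← add_vadd, add_comm]
    · have hr0 : (0 : ℝ) < r := by exact_mod_cast hr.1
      have hrq : (r : ℝ) < q := by exact_mod_cast hr.2
      have := hright (c + r) (by linarith) (by linarith)
      rwa [← add_vadd, add_comm]

end Upcrossings

/-! ### Local occupation times along the orbits. -/

section WindowMeasure

variable {X : Type*} [AddAction ℝ X]

/-- The Lebesgue measure of the visits to `B` in the time window `[-h, h]`. -/
noncomputable def windowMeasure (B : Set X) (h : ℝ) (x : X) : ℝ :=
  volume.real {t : ℝ | t ∈ Metric.closedBall 0 h ∧ t +ᵥ x ∈ B}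

theorem windowMeasure_vadd (B : Set X) (h : ℝ) (x : X) (s : ℝ) :
    windowMeasure B h (s +ᵥ x) = volume.real (orbitTrace B x ∩ Metric.closedBall s h) := by
  have : {t : ℝ | t ∈ Metric.closedBall 0 h ∧ t +ᵥ s +ᵥ x ∈ B} =
      (fun t => t + s) ⁻¹' (orbitTrace B x ∩ Metric.closedBall s h) := by
    ext t
    simp only [Set.mem_ofPred_eq, Set.mem_preimage, Set.mem_inter_iff, mem_orbitTrace,
      Metric.mem_closedBall, Real.dist_eq, sub_zero, add_sub_cancel_right, add_vadd]
    exact and_comm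
  rw [windowMeasure, this, measureReal_def, measure_preimage_add_right, ← measureReal_def]

theorem measurable_windowMeasure [MeasurableSpace X] [MeasurableVAdd₂ ℝ X] {B : Set X}
    (hB : MeasurableSet B) (h : ℝ) : Measurable (windowMeasure B h) := by
  have hm : MeasurableSet {p : X × ℝ | p.2 ∈ Metric.closedBall (0 : ℝ) h ∧ p.2 +ᵥ p.1 ∈ B} :=
    (measurable_snd Metric.isClosed_closedBall.measurableSet).inter
      ((measurable_snd.vadd measurable_fst) hB)
  exact (measurable_measure_prodMk_left hm).ennreal_toReal

theorem windowMeasure_vadd_le (B : Set X) (h : ℝ) (x : X) (s : ℝ) :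
    windowMeasure B h (s +ᵥ x) ≤ windowMeasure B h x + 2 * |s| := by
  rw [windowMeasure_vadd]
  conv_rhs => rw [← zero_vadd ℝ x, windowMeasure_vadd]
  set E := orbitTrace B x
  have hsub : E ∩ Metric.closedBall s h ⊆ (E ∩ Metric.closedBall 0 h) ∪
      (Set.Icc (-h - |s|) (-h) ∪ Set.Icc h (h + |s|)) := by
    rintro t ⟨htE, ht⟩
    rw [Metric.mem_closedBall, Real.dist_eq, abs_le] at ht
    have h1 := neg_abs_le s
    have h2 := le_abs_self s
    by_cases hb : t ∈ Metric.closedBall 0 h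
    · exact Or.inl ⟨htE, hb⟩
    · rw [Metric.mem_closedBall, Real.dist_eq, sub_zero, abs_le, not_and_or, not_le, not_le] at hb
      rcases hb with hb | hb
      · exact Or.inr (Or.inl ⟨by linarith, hb.le⟩)
      · exact Or.inr (Or.inr ⟨hb.le, by linarith⟩)
  have hfin : volume (E ∩ Metric.closedBall 0 h) ≠ ⊤ :=
    measure_ne_top_of_subset Set.inter_subset_right measure_closedBall_lt_top.ne
  calc volume.real (E ∩ Metric.closedBall s h) ≤ _ := measureReal_mono hsub
        (measure_union_lt_top hfin.lt_top
          (measure_union_lt_top measure_Icc_lt_top measure_Icc_lt_top)).ne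
    _ ≤ _ := measureReal_union_le _ _
    _ ≤ _ := add_le_add le_rfl (measureReal_union_le _ _)
    _ = _ := by
      rw [Real.volume_real_Icc_of_le (by linarith [abs_nonneg s]),
        Real.volume_real_Icc_of_le (by linarith [abs_nonneg s])]
      ring

theorem abs_windowMeasure_vadd_sub_le (B : Set X) (h : ℝ) (x : X) (s : ℝ) :
    |windowMeasure B h (s +ᵥ x) - windowMeasure B h x| ≤ 2 * |s| := by
  have h1 := windowMeasure_vadd_le B h x s
  have h2 := windowMeasure_vadd_le B h (s +ᵥ x) (-s)
  rw [neg_vadd_vadd, abs_neg] at h2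
  rw [abs_le]
  constructor <;> linarith

/-- On each orbit of a free flow, one of the window measures of countably many separating Borel sets
is not constant. -/
theorem exists_windowMeasure_ne [MeasurableSpace X] [MeasurableVAdd₂ ℝ X] (hfree : IsFreeFlow X)
    {B : ℕ → Set X} (hB : ∀ n, MeasurableSet (B n))
    (hsep : ∀ x y : X, (∀ n, x ∈ B n ↔ y ∈ B n) → x = y) (x : X) :
    ∃ (n k : ℕ) (s : ℝ), windowMeasure (B n) (1 / (k + 1)) (s +ᵥ x) ≠
      windowMeasure (B n) (1 / (k + 1)) x := by
  by_contra! hconst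
  have htr : ∀ n, MeasurableSet (orbitTrace (B n) x) := fun n => measurable_vadd_const x (hB n)
  -- By Lebesgue density the window measures determine, for almost every time, which sets `B n`
  -- contain the point. Were they all constant, two distinct density times would give the same
  -- point, against freeness.
  have hdens : ∀ᵐ t : ℝ, ∀ n, Tendsto (fun k : ℕ =>
      volume (orbitTrace (B n) x ∩ Metric.closedBall t (1 / (k + 1))) /
        volume (Metric.closedBall t (1 / (k + 1)))) atTop
      (𝓝 ((orbitTrace (B n) x).indicator 1 t)) := by
    rw [ae_all_iff]
    intro n
    filter_upwards [Besicovitch.ae_tendsto_measure_inter_div_of_measurableSet volume (htr n)]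
      with t ht
    refine ht.comp (tendsto_nhdsWithin_iff.2 ⟨tendsto_one_div_add_atTop_nhds_zero_nat, ?_⟩)
    exact Eventually.of_forall fun k => by
      simp only [Set.mem_Ioi]; positivity
  obtain ⟨t, ht⟩ := hdens.exists
  obtain ⟨t', ht', hne⟩ := (hdens.and (compl_mem_ae_iff.2 (Real.volume_singleton (a := t)))).exists
  refine hne ?_
  have hxt : t' +ᵥ x = t +ᵥ x := by
    refine hsep _ _ fun n => ?_
    have hseq : ∀ k : ℕ, volume (orbitTrace (B n) x ∩ Metric.closedBall t' (1 / (k + 1))) /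
        volume (Metric.closedBall t' (1 / (k + 1) : ℝ)) =
        volume (orbitTrace (B n) x ∩ Metric.closedBall t (1 / (k + 1))) /
        volume (Metric.closedBall t (1 / (k + 1) : ℝ)) := by
      intro k
      have h1 := (hconst n k t').trans (hconst n k t).symm
      rw [windowMeasure_vadd, windowMeasure_vadd, measureReal_def, measureReal_def,
        ENNReal.toReal_eq_toReal_iff'
          (measure_ne_top_of_subset Set.inter_subset_right measure_closedBall_lt_top.ne)
          (measure_ne_top_of_subset Set.inter_subset_right measure_closedBall_lt_top.ne)] at h1
      rw [h1, Real.volume_closedBall, Real.volume_closedBall]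
    have hlim := tendsto_nhds_unique ((ht' n).congr hseq) (ht n)
    by_cases h1 : t' ∈ orbitTrace (B n) x <;> by_cases h2 : t ∈ orbitTrace (B n) x
    · exact iff_of_true h1 h2
    · simp [h1, h2] at hlim
    · simp [h1, h2] at hlim
    · exact iff_of_false h1 h2
  have := hfree (t +ᵥ x) (t' - t) (by rw [← add_vadd, sub_add_cancel, hxt])
  exact sub_eq_zero.1 this

end WindowMeasure

/-! ### From an oscillating function to a cross section. -/

section Existence

variable {X : Type*} [MeasurableSpace X] [AddAction ℝ X] [MeasurableVAdd₂ ℝ X]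

/-- A countable family of functions that are Lipschitz on the orbits, one of which oscillates on
each orbit, can be glued and normalized. -/
theorem exists_lipschitz_oscillating_of_family {F : ℕ → X → ℝ} {a b : ℕ → ℝ}
    (hFm : ∀ N, Measurable (F N)) (hF : ∀ N x (t : ℝ), |F N (t +ᵥ x) - F N x| ≤ 2 * |t|)
    (hex : ∀ x, ∃ N, a N < b N ∧ (∃ t : ℝ, F N (t +ᵥ x) < a N) ∧ ∃ t : ℝ, b N < F N (t +ᵥ x)) :
    ∃ H u : X → ℝ, Measurable H ∧ Measurable u ∧ (∀ x, 0 < u x) ∧ (∀ x, u x ≤ 1) ∧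
      (∀ (t : ℝ) x, u (t +ᵥ x) = u x) ∧ (∀ x (t : ℝ), u x * |H (t +ᵥ x) - H x| ≤ |t|) ∧
      (∀ x, ∃ t : ℝ, H (t +ᵥ x) < (0 : ℝ)) ∧ ∀ x, ∃ t : ℝ, (1 : ℝ) < H (t +ᵥ x) := by
  classical
  let p : X → ℕ → Prop := fun x N =>
    a N < b N ∧ (∃ t : ℝ, F N (t +ᵥ x) < a N) ∧ ∃ t : ℝ, b N < F N (t +ᵥ x)
  have hFc : ∀ N x, Continuous fun t : ℝ => F N (t +ᵥ x) := by
    intro N x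
    refine (LipschitzWith.of_dist_le_mul (K := 2) fun s t => ?_).continuous
    have := hF N (t +ᵥ x) (s - t)
    rwa [← add_vadd, sub_add_cancel] at this
  have hpm : ∀ N, MeasurableSet {x | p x N} := by
    intro N
    have hm : ∀ t : ℝ, Measurable fun x => F N (t +ᵥ x) := fun t =>
      (hFm _).comp (measurable_const_vadd t)
    have hp' : ∀ x, p x N ↔ a N < b N ∧ (∃ q : ℚ, F N ((q : ℝ) +ᵥ x) < a N) ∧
        ∃ q : ℚ, b N < F N ((q : ℝ) +ᵥ x) := by
      intro x
      refine and_congr Iff.rfl (and_congr ⟨fun h => ?_, fun ⟨q, h⟩ => ⟨q, h⟩⟩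
        ⟨fun h => ?_, fun ⟨q, h⟩ => ⟨q, h⟩⟩)
      · obtain ⟨q, hq⟩ := exists_rat_add_mem (isOpen_lt (hFc N x) continuous_const) h 0
        rw [zero_add] at hq
        exact ⟨q, hq⟩
      · obtain ⟨q, hq⟩ := exists_rat_add_mem (isOpen_lt continuous_const (hFc N x)) h 0
        rw [zero_add] at hq
        exact ⟨q, hq⟩
    simp only [hp']
    refine measurableSet_setOfPred.2 (measurable_const.and (Measurable.and ?_ ?_))
    · exact Measurable.exists fun q => measurableSet_setOfPred.1
        (measurableSet_lt (hm _) measurable_const)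
    · exact Measurable.exists fun q => measurableSet_setOfPred.1
        (measurableSet_lt measurable_const (hm _))
  have hpinv : ∀ (t : ℝ) x, p (t +ᵥ x) = p x := by
    intro t x
    funext N
    have hshift : ∀ Q : X → Prop, (∃ s : ℝ, Q (s +ᵥ t +ᵥ x)) ↔ ∃ s : ℝ, Q (s +ᵥ x) := fun Q =>
      ⟨fun ⟨s, h⟩ => ⟨s + t, by rwa [add_vadd]⟩,
        fun ⟨s, h⟩ => ⟨s - t, by rwa [← add_vadd, sub_add_cancel]⟩⟩
    exact propext (and_congr Iff.rfl (and_congr (hshift fun y => F N y < a N)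
      (hshift fun y => b N < F N y)))
  -- The least admissible index is constant on orbits, so the glued function stays Lipschitz along
  -- them.
  let idx : X → ℕ := fun x => Nat.find (hex x)
  have hspec : ∀ x, p x (idx x) := fun x => Nat.find_spec (hex x)
  have hidx : Measurable idx := measurable_find hex hpm
  have hidxinv : ∀ (t : ℝ) x, idx (t +ᵥ x) = idx x := by
    intro t x
    have h := hpinv t x
    exact Nat.find_congr' (fun {n} => iff_of_eq (congrFun h n))
  clear_value idx
  have hab : ∀ x, 0 < b (idx x) - a (idx x) := fun x => sub_pos.2 (hspec x).1
  refine ⟨fun x => (F (idx x) x - a (idx x)) / (b (idx x) - a (idx x)),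
    -- The Lipschitz constant `2` becomes `2 / (b - a)` after normalization; the cap `1` serves the
    -- final bound on the cocycle.
    fun x => min 1 ((b (idx x) - a (idx x)) / 2), ?_, ?_,
    fun x => lt_min one_pos (half_pos (hab x)), fun x => min_le_left _ _,
    fun t x => by simp only [hidxinv], fun x t => ?_, fun x => ?_, fun x => ?_⟩
  · have : Measurable fun z : ℕ × X => (F z.1 z.2 - a z.1) / (b z.1 - a z.1) :=
      measurable_from_prod_countable_right fun N =>
        ((hFm N).sub_const (a N)).div_const (b N - a N)
    exact this.comp (hidx.prodMk measurable_id)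
  · exact (measurable_from_nat (f := fun N => min 1 ((b N - a N) / 2))).comp hidx
  · have h1 := hab x
    simp only [hidxinv]
    rw [← sub_div, sub_sub_sub_cancel_right, abs_div, abs_of_pos h1]
    calc _ ≤ ((b (idx x) - a (idx x)) / 2) * (2 * |t| / (b (idx x) - a (idx x))) := by
          gcongr
          · exact min_le_right _ _
          · exact hF _ _ _
      _ = |t| := by field_simp
  · obtain ⟨t, ht⟩ := (hspec x).2.1
    refine ⟨t, ?_⟩
    simp only [hidxinv]
    exact div_neg_of_neg_of_pos (by linarith) (hab x)
  · obtain ⟨t, ht⟩ := (hspec x).2.2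
    refine ⟨t, ?_⟩
    simp only [hidxinv]
    rw [one_lt_div (hab x)]
    linarith

variable [StandardBorelSpace X]

/-- There is a Borel function that is Lipschitz on each orbit and takes both values below `0` and
values above `1` there. -/
theorem exists_lipschitz_oscillating (hfree : IsFreeFlow X) :
    ∃ H u : X → ℝ, Measurable H ∧ Measurable u ∧ (∀ x, 0 < u x) ∧ (∀ x, u x ≤ 1) ∧
      (∀ (t : ℝ) x, u (t +ᵥ x) = u x) ∧ (∀ x (t : ℝ), u x * |H (t +ᵥ x) - H x| ≤ |t|) ∧
      (∀ x, ∃ t : ℝ, H (t +ᵥ x) < (0 : ℝ)) ∧ ∀ x, ∃ t : ℝ, (1 : ℝ) < H (t +ᵥ x) := by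
  obtain ⟨B, hB, hsep⟩ := exists_seq_separating X (p := MeasurableSet) MeasurableSet.empty Set.univ
  obtain ⟨e, he⟩ := exists_surjective_nat (ℕ × ℕ × ℚ × ℚ)
  refine exists_lipschitz_oscillating_of_family
    (F := fun N => windowMeasure (B (e N).1) (1 / ((e N).2.1 + 1)))
    (a := fun N => (e N).2.2.1) (b := fun N => (e N).2.2.2)
    (fun N => measurable_windowMeasure (hB _) _) (fun N => abs_windowMeasure_vadd_sub_le _ _)
    fun x => ?_
  obtain ⟨n, k, s, hs⟩ := exists_windowMeasure_ne hfree hB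
    (fun x y => hsep x (Set.mem_univ _) y (Set.mem_univ _)) x
  have key : ∀ t₁ t₂ : ℝ, windowMeasure (B n) (1 / (k + 1)) (t₁ +ᵥ x) <
      windowMeasure (B n) (1 / (k + 1)) (t₂ +ᵥ x) → ∃ N, ((e N).2.2.1 : ℝ) < (e N).2.2.2 ∧
      (∃ t : ℝ, windowMeasure (B (e N).1) (1 / ((e N).2.1 + 1)) (t +ᵥ x) < (e N).2.2.1) ∧
      ∃ t : ℝ, ((e N).2.2.2 : ℝ) < windowMeasure (B (e N).1) (1 / ((e N).2.1 + 1)) (t +ᵥ x) := by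
    intro t₁ t₂ hlt
    obtain ⟨a, ha1, ha2⟩ := exists_rat_btwn hlt
    obtain ⟨b, hb1, hb2⟩ := exists_rat_btwn ha2
    obtain ⟨N, hN⟩ := he (n, k, a, b)
    refine ⟨N, ?_⟩
    rw [hN]
    exact ⟨hb1, ⟨t₁, ha1⟩, ⟨t₂, hb2⟩⟩
  rcases lt_or_gt_of_ne hs with h | h
  · exact key s 0 (by rwa [zero_vadd])
  · exact key 0 s (by rwa [zero_vadd])

/-- Every free Borel flow has a Borel cross section. -/
theorem exists_isCrossSection (hfree : IsFreeFlow X) : ∃ (C : Set X) (u : X → ℝ),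
    MeasurableSet C ∧ Measurable u ∧ (∀ x, u x ≤ 1) ∧ IsCrossSection C u := by
  obtain ⟨H, u, hH, hu, hpos, hle, hinv, hlip, hneg, hone⟩ := exists_lipschitz_oscillating hfree
  have hcont : ∀ x, Continuous fun t : ℝ => H (t +ᵥ x) := by
    intro x
    refine (LipschitzWith.of_dist_le_mul (K := ⟨(u x)⁻¹, (inv_pos.2 (hpos x)).le⟩)
      fun s t => ?_).continuous
    have h1 := hlip (t +ᵥ x) (s - t)
    rw [hinv, ← add_vadd, sub_add_cancel] at h1
    change _ ≤ (u x)⁻¹ * _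
    rw [Real.dist_eq, Real.dist_eq, inv_mul_eq_div, le_div_iff₀ (hpos x), mul_comm]
    exact h1
  -- An orbit may have its high values only before its low ones; upcrossings of `1 - H` handle this.
  -- Where `H` has an upcrossing it is at most `0`, where `G` has one `H` is at least `1`, so mixed
  -- pairs are also `u` apart.
  let G : X → ℝ := fun x => 1 - H x
  have hGcont : ∀ x, Continuous fun t : ℝ => G (t +ᵥ x) := fun x => continuous_const.sub (hcont x)
  have hGlip : ∀ x (t : ℝ), u x * |G (t +ᵥ x) - G x| ≤ |t| := by
    intro x t
    have : G (t +ᵥ x) - G x = -(H (t +ᵥ x) - H x) := by simp only [G]; ring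
    rw [this, abs_neg]
    exact hlip x t
  let C : Set X := upcrossingSet H ∪ upcrossingSet G
  have hCm : MeasurableSet C := (measurableSet_upcrossingSet hH).union
    (measurableSet_upcrossingSet (hH.const_sub 1))
  have hsep : ∀ x (t : ℝ), 0 < t → x ∈ C → t +ᵥ x ∈ C → u x ≤ t := by
    intro x t ht hx hxt
    have hl := hlip x t
    rw [abs_of_pos ht] at hl
    have hu := hpos x
    rcases hx with hx | hx <;> rcases hxt with hxt | hxt
    · exact upcrossingSet_separated (hpos x) (hcont x) (hlip x) ht hx hxt
    · have h1 := le_zero_of_mem_upcrossingSet (hcont _) hx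
      have h2 : 1 - H (t +ᵥ x) ≤ 0 := le_zero_of_mem_upcrossingSet (H := G) (hGcont _) hxt
      have h3 := le_abs_self (H (t +ᵥ x) - H x)
      nlinarith
    · have h1 : 1 - H x ≤ 0 := le_zero_of_mem_upcrossingSet (H := G) (hGcont _) hx
      have h2 := le_zero_of_mem_upcrossingSet (hcont _) hxt
      have h3 := neg_abs_le (H (t +ᵥ x) - H x)
      nlinarith
    · exact upcrossingSet_separated (hpos x) (hGcont x) (hGlip x) ht hx hxt
  have hne : ∀ x, ∃ t : ℝ, t +ᵥ x ∈ C := by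
    intro x
    obtain ⟨a, ha⟩ := hneg x
    obtain ⟨b, hb⟩ := hone x
    rcases lt_trichotomy a b with h | rfl | h
    · obtain ⟨c, hc⟩ := exists_mem_upcrossingSet (hcont x) h ha hb
      exact ⟨c, Or.inl hc⟩
    · linarith
    · obtain ⟨c, hc⟩ := exists_mem_upcrossingSet (hGcont x) h
        (show 1 - H (b +ᵥ x) < 0 by linarith) (show 1 < 1 - H (a +ᵥ x) by linarith)
      exact ⟨c, Or.inr hc⟩
  exact ⟨filling C u, u, measurableSet_filling hCm hu hpos hinv hsep, hu, hle,
    isCrossSection_filling hpos hinv hsep hne⟩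

end Existence

/-! ### Recurrence of ergodic maps of the line -/

theorem measurable_symm_of_measurable {X : Type*} [MeasurableSpace X] [StandardBorelSpace X]
    (e : Equiv.Perm X) (he : Measurable e) : Measurable e.symm := by
  intro A hA
  rw [← e.image_eq_preimage_symm]
  exact (he.measurableEmbedding e.injective).measurableSet_image' hA

/-- Having no atoms, Lebesgue measure leaves two different points near which `W` has positive
measure; disjoint neighbourhoods separate them. -/
theorem exists_disjoint_subsets_pos {W : Set ℝ} (hW : MeasurableSet W) (hpos : volume W ≠ 0) :
    ∃ W₁ W₂ : Set ℝ, MeasurableSet W₁ ∧ W₁ ⊆ W ∧ W₂ ⊆ W ∧ Disjoint W₁ W₂ ∧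
      volume W₁ ≠ 0 ∧ volume W₂ ≠ 0 := by
  obtain ⟨a, -, ha⟩ := exists_mem_forall_mem_nhdsWithin_pos_measure hpos
  have hpos' : volume (W \ {a}) ≠ 0 := by
    rwa [measure_sdiff_null Real.volume_singleton]
  obtain ⟨b, ⟨-, hba⟩, hb⟩ := exists_mem_forall_mem_nhdsWithin_pos_measure hpos'
  obtain ⟨U, V, hU, hV, haU, hbV, hUV⟩ := t2_separation (Ne.symm hba : a ≠ b)
  refine ⟨W ∩ U, (W \ {a}) ∩ V, hW.inter hU.measurableSet, Set.inter_subset_left,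
    Set.inter_subset_left.trans Set.sdiff_subset,
    hUV.mono Set.inter_subset_right Set.inter_subset_right, ?_, ?_⟩
  · exact (ha _ (inter_mem_nhdsWithin _ (hU.mem_nhds haU))).ne'
  · exact (hb _ (inter_mem_nhdsWithin _ (hV.mem_nhds hbV))).ne'

/-- An ergodic bijection of the line is conservative. -/
theorem Ergodic.conservative_of_bijective {f : ℝ → ℝ} (hf : Ergodic f volume)
    (hbij : Function.Bijective f) : Conservative f volume := by
  refine ⟨hf.toMeasurePreserving.quasiMeasurePreserving, fun W hW hpos => ?_⟩
  by_contra! hwand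
  let σ : Equiv.Perm ℝ := Equiv.ofBijective f hbij
  have hσ : Measurable σ := hf.measurable
  have hσ' : Measurable σ.symm := measurable_symm_of_measurable σ hσ
  have hpow : ∀ (n : ℕ) (x : ℝ), (σ ^ n) x = f^[n] x := fun n x => by
    rw [Equiv.Perm.coe_pow]
    rfl
  have hσk : ∀ k : ℤ, Measurable (σ ^ k) := by
    intro k
    cases k with
    | ofNat n =>
      rw [Int.ofNat_eq_natCast, zpow_natCast, Equiv.Perm.coe_pow]
      exact hσ.iterate n
    | negSucc n =>
      rw [zpow_negSucc, ← inv_pow, Equiv.Perm.coe_pow]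
      exact hσ'.iterate (n + 1)
  obtain ⟨W₁, W₂, hW₁m, hW₁, hW₂, hdisj, hpos₁, hpos₂⟩ := exists_disjoint_subsets_pos hW hpos
  -- The saturation of one half of a wandering set is invariant and misses the other half, so it is
  -- neither null nor conull.
  let V : Set ℝ := ⋃ k : ℤ, (σ ^ k) ⁻¹' W₁
  have hVm : MeasurableSet V := MeasurableSet.iUnion fun k => hσk k hW₁m
  have hVinv : f ⁻¹' V = V := by
    ext x
    simp only [V, Set.mem_preimage, Set.mem_iUnion]
    have hshift : ∀ k : ℤ, (σ ^ k) (f x) = (σ ^ (k + 1)) x := fun k => by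
      rw [zpow_add_one]
      rfl
    simp only [hshift]
    exact ⟨fun ⟨k, h⟩ => ⟨k + 1, h⟩, fun ⟨k, h⟩ => ⟨k - 1, by rwa [sub_add_cancel]⟩⟩
  have hW₂V : W₂ ⊆ Vᶜ := by
    intro x hx hxV
    obtain ⟨k, hk⟩ := Set.mem_iUnion.1 hxV
    rcases lt_trichotomy k 0 with hk0 | rfl | hk0
    · obtain ⟨n, rfl⟩ : ∃ n : ℕ, k = -n := ⟨k.natAbs, by omega⟩
      refine hwand _ (hW₁ hk) n (by omega) ?_
      rw [← hpow, ← zpow_natCast, ← Equiv.Perm.mul_apply, ← zpow_add, add_neg_cancel, zpow_zero]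
      exact hW₂ hx
    · exact Set.disjoint_left.1 hdisj hk hx
    · obtain ⟨n, rfl⟩ : ∃ n : ℕ, k = n := ⟨k.natAbs, by omega⟩
      refine hwand x (hW₂ hx) n (by omega) ?_
      rw [← hpow, ← zpow_natCast]
      exact hW₁ hk
  rcases hf.measure_self_or_compl_eq_zero hVm hVinv with h | h
  · refine hpos₁ (measure_mono_null (fun x hx => Set.mem_iUnion.2 ⟨0, ?_⟩) h)
    rwa [zpow_zero]
  · exact hpos₂ (measure_mono_null hW₂V h)

/-- The set of points visiting `s` infinitely often is invariant, and by Poincaré recurrence it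
contains almost all of `s`. -/
theorem Ergodic.ae_frequently_mem_of_conservative {α : Type*} [MeasurableSpace α] {μ : Measure α}
    {f : α → α} (hf : Ergodic f μ) (hc : Conservative f μ) {s : Set α} (hs : MeasurableSet s)
    (hpos : μ s ≠ 0) : ∀ᵐ x ∂μ, ∃ᶠ n in atTop, f^[n] x ∈ s := by
  let V : Set α := {x | ∃ᶠ n in atTop, f^[n] x ∈ s}
  have hVm : MeasurableSet V := by
    have : V = limsup (fun n => f^[n] ⁻¹' s) atTop := by
      ext x
      rw [mem_limsup_iff_frequently_mem]
      rfl
    rw [this]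
    exact MeasurableSet.measurableSet_limsup fun n => hf.measurable.iterate n hs
  have hVinv : f ⁻¹' V = V := by
    ext x
    change (∃ᶠ n in atTop, f^[n] (f x) ∈ s) ↔ ∃ᶠ n in atTop, f^[n] x ∈ s
    simp only [← Function.iterate_succ_apply]
    conv_rhs => rw [← map_add_atTop_eq_nat 1, frequently_map]
  rcases hf.ae_mem_or_ae_notMem hVm hVinv with h | h
  · exact h
  · refine absurd ?_ hpos
    rw [← compl_compl s]
    refine mem_ae_iff.1 ?_
    filter_upwards [h, hc.ae_mem_imp_frequently_image_mem hs.nullMeasurableSet] with x h1 h2 h3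
    exact h1 (h2 h3)

theorem Ergodic.ae_frequently_lt_and_gt {f : ℝ → ℝ} (hf : Ergodic f volume)
    (hbij : Function.Bijective f) :
    ∀ᵐ t, (∃ᶠ n in atTop, t < f^[n] t) ∧ ∃ᶠ n in atTop, f^[n] t < t := by
  have hint : ∀ᵐ t, ∀ N : ℤ, ∃ᶠ n in atTop, f^[n] t ∈ Set.Ioo (N : ℝ) (N + 1) := by
    rw [ae_all_iff]
    intro N
    refine hf.ae_frequently_mem_of_conservative (hf.conservative_of_bijective hbij)
      measurableSet_Ioo ?_
    simp
  filter_upwards [hint] with t ht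
  constructor
  · exact (ht (⌊t⌋ + 1)).mono fun n hn => by
      have := Int.lt_floor_add_one t
      have := hn.1
      push_cast at this
      linarith
  · exact (ht (⌊t⌋ - 1)).mono fun n hn => by
      have := Int.floor_le t
      have := hn.2
      push_cast at this
      linarith

/-! ### Averaging over the flow -/

section Averaging

variable {X : Type*} [MeasurableSpace X] {μ : Measure X} [IsProbabilityMeasure μ]
  [AddAction ℝ X] [MeasurableVAdd₂ ℝ X] [VAddInvariantMeasure ℝ X μ]

/-- Fubini for the set of pairs `(t, x)` whose translate lies in `D`, with invariance of `μ` under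
each time `t`. -/
theorem lintegral_volume_inter_orbitTrace {D : Set X} (hD : MeasurableSet D) {I : Set ℝ}
    (hI : MeasurableSet I) :
    ∫⁻ x, volume (orbitTrace D x ∩ I) ∂μ = volume I * μ D := by
  have hm : MeasurableSet {p : ℝ × X | p.1 +ᵥ p.2 ∈ D} := (measurable_fst.vadd measurable_snd) hD
  have h1 := Measure.prod_apply (μ := volume.restrict I) (ν := μ) hm
  have h2 := Measure.prod_apply_symm (μ := volume.restrict I) (ν := μ) hm
  have h3 : ∀ t : ℝ, μ (Prod.mk t ⁻¹' {p : ℝ × X | p.1 +ᵥ p.2 ∈ D}) = μ D := fun t =>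
    measure_preimage_vadd μ t D
  have h4 : ∀ x : X, volume.restrict I ((fun t : ℝ => (t, x)) ⁻¹' {p : ℝ × X | p.1 +ᵥ p.2 ∈ D}) =
      volume (orbitTrace D x ∩ I) := fun x =>
    Measure.restrict_apply' hI
  simp only [h3, lintegral_const, Measure.restrict_apply_univ] at h1
  simp only [h4] at h2
  rw [← h2, h1, mul_comm]

theorem measure_eq_zero_of_orbitTrace {D : Set X} (hD : MeasurableSet D)
    (h : ∀ x, volume (orbitTrace D x) = 0) : μ D = 0 := by
  have h1 := lintegral_volume_inter_orbitTrace (μ := μ) hD (I := Set.Icc 0 1) measurableSet_Icc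
  have h2 : ∀ x, volume (orbitTrace D x ∩ Set.Icc 0 1) = 0 := fun x =>
    measure_mono_null Set.inter_subset_left (h x)
  simpa [h2] using h1.symm

theorem volume_preimage_inter_Icc_le {f : ℝ → ℝ} (hf : MeasurePreserving f volume volume) {K : ℝ}
    (hK : ∀ t, |f t - t| ≤ K) {E : Set ℝ} (hE : MeasurableSet E) (L : ℝ) :
    volume (f ⁻¹' E ∩ Set.Icc 0 L) ≤ volume (E ∩ Set.Icc (-K) (L + K)) := by
  rw [← hf.measure_preimage (hE.inter measurableSet_Icc).nullMeasurableSet]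
  refine measure_mono fun t ht => ⟨ht.1, ?_⟩
  have h1 := abs_le.1 (hK t)
  have h2 := ht.2
  exact ⟨by linarith [h2.1], by linarith [h2.2]⟩

/-- A map along the orbits with bounded displacement preserves the measure if it preserves Lebesgue
measure on each orbit. -/
theorem measurePreserving_of_orbits {d : X → ℝ} (hd : Measurable d) {K : ℝ} (hK : ∀ x, |d x| ≤ K)
    (hmp : ∀ x, MeasurePreserving (fun t : ℝ => d (t +ᵥ x) + t) volume volume) :
    MeasurePreserving (fun x => d x +ᵥ x) μ μ := by
  have hS : Measurable fun x => d x +ᵥ x := hd.vadd measurable_id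
  have hK0 : 0 ≤ K := by
    obtain ⟨x⟩ := nonempty_of_isProbabilityMeasure μ
    exact (abs_nonneg _).trans (hK x)
  have key : ∀ A, MeasurableSet A → μ.real ((fun x => d x +ᵥ x) ⁻¹' A) ≤ μ.real A := by
    intro A hA
    have hL : ∀ L : ℝ, 0 < L →
        L * μ.real ((fun x => d x +ᵥ x) ⁻¹' A) ≤ (L + 2 * K) * μ.real A := by
      intro L hL
      have h1 := lintegral_volume_inter_orbitTrace (μ := μ) (hS hA) (I := Set.Icc 0 L)
        measurableSet_Icc
      have h2 := lintegral_volume_inter_orbitTrace (μ := μ) hA (I := Set.Icc (-K) (L + K))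
        measurableSet_Icc
      have h3 : ∀ x, volume (orbitTrace ((fun x => d x +ᵥ x) ⁻¹' A) x ∩ Set.Icc 0 L) ≤
          volume (orbitTrace A x ∩ Set.Icc (-K) (L + K)) := by
        intro x
        have h4 : orbitTrace ((fun x => d x +ᵥ x) ⁻¹' A) x =
            (fun t : ℝ => d (t +ᵥ x) + t) ⁻¹' orbitTrace A x := by
          ext t
          simp only [orbitTrace, Set.mem_preimage, add_vadd]
        rw [h4]
        exact volume_preimage_inter_Icc_le (hmp x) (fun t => by
          rw [add_sub_cancel_right]; exact hK _) (measurable_vadd_const x hA) L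
      have h5 := lintegral_mono h3 (μ := μ)
      rw [h1, h2, Real.volume_Icc, Real.volume_Icc] at h5
      have h6 := ENNReal.toReal_mono (by finiteness) h5
      rw [ENNReal.toReal_mul, ENNReal.toReal_mul, ENNReal.toReal_ofReal (by linarith),
        ENNReal.toReal_ofReal (by linarith)] at h6
      simp only [measureReal_def]
      convert h6 using 2 <;> ring
    by_contra! hlt
    set a := μ.real ((fun x => d x +ᵥ x) ⁻¹' A)
    set b := μ.real A
    have hb : 0 ≤ b := measureReal_nonneg
    have hab : 0 < a - b := by linarith
    -- The boundary error `2 * K * b` does not grow with the window, so a window longer than `2 * K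
    -- * b / (a - b)` is contradictory.
    have h7 := hL (2 * K * b / (a - b) + 1) (by positivity)
    have h8 : (2 * K * b / (a - b)) * (a - b) = 2 * K * b := by field_simp
    nlinarith
  refine ⟨hS, Measure.ext fun A hA => ?_⟩
  rw [Measure.map_apply hS hA, ← measureReal_eq_measureReal_iff]
  refine le_antisymm (key A hA) ?_
  -- In a probability space the inequality for the complement is the reverse inequality for `A`.
  have h1 := key Aᶜ hA.compl
  rw [Set.preimage_compl, measureReal_compl (hS hA), measureReal_compl hA] at h1
  linarith

end Averaging

/-! ### The element of the full group -/

section FullGroup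

variable {X : Type*} [AddAction ℝ X] {d : X → ℝ}

theorem bijective_of_orbits
    (hbij : ∀ x, Function.Bijective fun t : ℝ => d (t +ᵥ x) + t) :
    Function.Bijective fun x => d x +ᵥ x := by
  constructor
  · intro x y hxy
    simp only at hxy
    have hy : y = (-d y + d x) +ᵥ x := by rw [add_vadd, hxy, neg_vadd_vadd]
    set s := -d y + d x with hs
    have h0 : (d (s +ᵥ x) + s - d ((0 : ℝ) +ᵥ x)) = 0 := by
      rw [← hy, zero_vadd, hs]
      ring
    have h1 : s = 0 := (hbij x).1 (a₁ := s) (a₂ := 0) (by simp only; linarith)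
    rw [hy, h1, zero_vadd]
  · intro y
    obtain ⟨t, ht⟩ := (hbij y).2 0
    refine ⟨t +ᵥ y, ?_⟩
    simp only at ht ⊢
    rw [← add_vadd, ht, zero_vadd]

theorem iterate_vadd_orbit (x : X) (t : ℝ) (n : ℕ) :
    (fun x => d x +ᵥ x)^[n] (t +ᵥ x) = ((fun t : ℝ => d (t +ᵥ x) + t)^[n] t) +ᵥ x := by
  induction n with
  | zero => rfl
  | succ n ih => rw [Function.iterate_succ_apply', ih, Function.iterate_succ_apply', add_vadd]

/-- The cocycle is defined by choice; an explicit Borel displacement shows that the cocycles of the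
powers are Borel. -/
theorem exists_measurable_displacement_iterate [MeasurableSpace X] [MeasurableVAdd₂ ℝ X]
    (hd : Measurable d) (n : ℕ) :
    ∃ D : X → ℝ, Measurable D ∧ ∀ x, (fun x => d x +ᵥ x)^[n] x = D x +ᵥ x := by
  induction n with
  | zero => exact ⟨fun _ => 0, measurable_const, fun x => by simp⟩
  | succ n ih =>
    obtain ⟨D, hD, hDx⟩ := ih
    refine ⟨fun x => D (d x +ᵥ x) + d x, (hD.comp (hd.vadd measurable_id)).add hd, fun x => ?_⟩
    rw [Function.iterate_succ_apply, hDx, add_vadd]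

/-- A displacement function that is bounded and ergodic on all orbits defines an element of the
full group with the wanted properties. -/
theorem exists_mem_fullGroup_of_displacement [MeasurableSpace X] [StandardBorelSpace X]
    (μ : Measure X) [IsProbabilityMeasure μ] [MeasurableVAdd₂ ℝ X] [VAddInvariantMeasure ℝ X μ]
    (hfree : IsFreeFlow X) (hd : Measurable d) {K : ℝ} (hK : ∀ x, |d x| ≤ K)
    (hbij : ∀ x, Function.Bijective fun t : ℝ => d (t +ᵥ x) + t)
    (herg : ∀ x, Ergodic (fun t : ℝ => d (t +ᵥ x) + t) volume) :
    ∃ S ∈ fullGroup μ,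
      (∀ x, |cocycleMap S x| ≤ K) ∧
      (∀ x, ErgodicOnOrbit S x) ∧
      (∀ᵐ x ∂μ, (∃ᶠ k : ℕ in atTop, 0 < cocycleMap (S ^ k) x) ∧
        (∃ᶠ k : ℕ in atTop, cocycleMap (S ^ k) x < 0)) := by
  let S : Equiv.Perm X := Equiv.ofBijective _ (bijective_of_orbits hbij)
  have hSd : ∀ x, S x = d x +ᵥ x := fun _ => rfl
  have hSfun : (S : X → X) = fun x => d x +ᵥ x := rfl
  have hSm : Measurable S := hd.vadd measurable_id
  have hSmp : MeasurePreserving S μ μ :=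
    measurePreserving_of_orbits hd hK fun x => (herg x).toMeasurePreserving
  have hSsymm : MeasurePreserving S.symm μ μ :=
    MeasurePreserving.symm ⟨S, hSm, measurable_symm_of_measurable S hSm⟩ hSmp
  have hpow : ∀ (k : ℕ) x, (S ^ k) x = (fun x => d x +ᵥ x)^[k] x := fun k x => by
    rw [Equiv.Perm.coe_pow, hSfun]
  refine ⟨S, ⟨hSmp, hSsymm, fun x => ⟨d x, rfl⟩⟩, fun x => ?_, fun x => ?_, ?_⟩
  · rw [cocycleMap, hSd, orbitCocycle_eq hfree]
    exact hK x
  · refine MeasurePreserving.ergodic_of_ergodic_semiconj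
      (g := fun t : ℝ => t +ᵥ x) ⟨measurable_vadd_const x, rfl⟩ (herg x) ?_ ?_
    · exact hSm
    · intro t
      simp only [hSd, add_vadd]
  · have hcoc : ∀ k : ℕ, Measurable fun x => cocycleMap (S ^ k) x := by
      intro k
      obtain ⟨D, hD, hDx⟩ := exists_measurable_displacement_iterate hd k
      have : (fun x => cocycleMap (S ^ k) x) = D := by
        funext x
        rw [cocycleMap, hpow, hDx, orbitCocycle_eq hfree]
      rwa [this]
    let G : Set X := limsup (fun k => {x | 0 < cocycleMap (S ^ k) x}) atTop ∩
      limsup (fun k => {x | cocycleMap (S ^ k) x < 0}) atTop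
    have hG : ∀ x, x ∈ G ↔ (∃ᶠ k : ℕ in atTop, 0 < cocycleMap (S ^ k) x) ∧
        (∃ᶠ k : ℕ in atTop, cocycleMap (S ^ k) x < 0) := by
      intro x
      rw [Set.mem_inter_iff, mem_limsup_iff_frequently_mem, mem_limsup_iff_frequently_mem]
      rfl
    have hGm : MeasurableSet G :=
      (MeasurableSet.measurableSet_limsup fun k => measurableSet_lt measurable_const (hcoc k)).inter
        (MeasurableSet.measurableSet_limsup fun k => measurableSet_lt (hcoc k) measurable_const)
    have hnull : μ Gᶜ = 0 := by
      -- Almost every time on every orbit is good, and Fubini turns this into almost every point.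
      refine measure_eq_zero_of_orbitTrace hGm.compl fun x => ?_
      have h := ae_iff.1 ((herg x).ae_frequently_lt_and_gt (hbij x))
      refine measure_mono_null ?_ h
      intro t ht hgood
      refine ht ((hG _).2 ?_)
      have hval : ∀ k : ℕ, cocycleMap (S ^ k) (t +ᵥ x) =
          (fun t : ℝ => d (t +ᵥ x) + t)^[k] t - t := by
        intro k
        have : (S ^ k) (t +ᵥ x) = ((fun t : ℝ => d (t +ᵥ x) + t)^[k] t - t) +ᵥ (t +ᵥ x) := by
          rw [hpow, iterate_vadd_orbit, ← add_vadd, sub_add_cancel]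
        rw [cocycleMap, this, orbitCocycle_eq hfree]
      simp only [hval, sub_pos, sub_neg]
      exact hgood
    filter_upwards [mem_ae_iff.2 hnull] with x hx
    exact (hG x).1 hx

end FullGroup

theorem mainTheorem9 {X : Type*} [MeasurableSpace X] [StandardBorelSpace X]
    (μ : Measure X) [IsProbabilityMeasure μ]
    [AddAction ℝ X] [MeasurableVAdd₂ ℝ X] [VAddInvariantMeasure ℝ X μ]
    (hfree : IsFreeFlow X) :
    ∃ S ∈ fullGroup μ,
      (∀ x, |cocycleMap S x| ≤ 4) ∧
      (∀ x, ErgodicOnOrbit S x) ∧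
      (∀ᵐ x ∂μ, (∃ᶠ k : ℕ in atTop, 0 < cocycleMap (S ^ k) x) ∧
        (∃ᶠ k : ℕ in atTop, cocycleMap (S ^ k) x < 0)) := by
  obtain ⟨C, u, hC, hu, hle, h⟩ := exists_isCrossSection hfree
  have hd := h.measurable_towerDisplacement hC hu
  have htower : ∀ x, ∃ c : ℤ → ℝ,
      IsTowerMap c (u x) (fun t : ℝ => towerDisplacement C u (t +ᵥ x) + t) := by
    intro x
    simp only [← towerDisplacement_orbitTrace h]
    exact (h.orbitTrace x).isTowerMap
  refine exists_mem_fullGroup_of_displacement μ hfree hd (fun x => ?_) (fun x => ?_) (fun x => ?_)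
  · obtain ⟨c, hc⟩ := htower x
    have h1 := hc.abs_sub_le 0
    rw [zero_vadd, add_zero, sub_zero] at h1
    linarith [hle x]
  · obtain ⟨c, hc⟩ := htower x
    exact ⟨hc.injective, hc.surjective⟩
  · obtain ⟨c, hc⟩ := htower x
    exact hc.ergodic ((hd.comp (measurable_vadd_const x)).add measurable_id)
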